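/- Let $2m\ge 4$ be an even number, let $0<L<\infty$, and let smooth functions $\kappa_i:[0,L)\to\mathbb R$ and angles $\alpha_i\in(0,\pi)$, $i=1,\dots,2m$, be given with $\sum_{i=1}^{2m}\alpha_i=2\pi$. Put $\beta_i=\sum_{j=1}^{i}\alpha_j$ and $\mathbf s_i=\cos(\beta_i)\,\mathbf e_1+\sin(\beta_i)\,\mathbf e_2$ for $0\le i\le 2m$ (so $\mathbf s_0=\mathbf s_{2m}$). For lengths $l_i>0$ put $l_0=l_{2m}$ and $$S_i=\{c\,\mathbf s_{i-1}+d\,\mathbf s_i:\ 0\le c<l_{i-1},\ 0\le d<l_i\}\ (1\le i\le 2m),\qquad T=T(\{\alpha_i\},\{l_i\})=\bigcup_{i=1}^{2m}S_i\subset\mathbb R^2$$ (an $m$-star). The asymptotic coordinates $(u,v)$ on $S_i$ are the two coefficients $c,d$, where $u$ is the coefficient of the one of $\mathbf s_{i-1},\mathbf s_i$ with even index and $v$ that of the one with odd index. An $m$-saddle on $T$ with normal field $N:T\to S^2$ is a map $r:T\to\mathbb R^3$ such that (a) $r$ is a $C^{1,1}$ immersion of the surface $T$ with Lipschitz unit normal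 $N$. That is, $N$ is Lipschitz on $T$, and every point of $T$ has a neighbourhood with a bi-Lipschitz coordinate system, onto an open subset of $\mathbb R^2$, in which $r$ is differentiable with Lipschitz derivative $Dr$, $\|Dr\,w\|$ is bounded above and below by positive multiples of $\|w\|$, and the range of $Dr$ is orthogonal to $N$; all constants are uniform on $T$. (b) On each sector $S_i$, $r$ and $N$ are $C^{1M}$ in the coordinates $(u,v)$ (they are $C^1$ and their mixed second derivatives exist, agree and are continuous, with one-sided derivatives on the boundary), $N_u,N_v,r_u,r_v$ do not vanish, $N_{uv}=\nu N$ for some continuous real function $\nu$, and the Lelieuvre equations $r_u=N_u\times N$ and $r_v=-N_v\times N$ hold. Then there is $\delta\in(0,L]$ such that for all lengths $l_i\in(0,\delta)$, $i=1,\dots,2m$, there exist $F_i:[0,l_i)\to SO(3)$, $i=1,\dots,2m$, and an $m$-saddle $r:T(\{\alpha_i\},\{l_i\})\to\mathbb R^3$ with normal field $N$ satisfying: 1. $r(0)=0$ and $N(0)=\mathbf e_3$. 2. $F_i$ is an arc-length parametrized Frenet frame, with rows $T_i,\ N_i\times T_i,\ N_i$, of geodesic curvature $\kappa_i$ and torsion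 $\tau_i$, where $\tau_i=-1$ for $i$ even and $\tau_i=+1$ for $i$ odd: $$F_i'=\begin{pmatrix}0&\kappa_i&0\\-\kappa_i&0&\tau_i\\0&-\tau_i&0\end{pmatrix}F_i,\qquad T_i(0)=\mathbf s_i,\quad N_i(0)=\mathbf e_3 .$$ 3. The sector boundaries are the curves with these frames: for all $i$ and $0\le t<l_i$, $\ \frac{d}{dt}\,r(t\,\mathbf s_i)=T_i(t)$ and $N(t\,\mathbf s_i)=N_i(t)$. -/

import Mathlib

open Set
open scoped NNReal ContDiff

noncomputable section

/-- The plane that contains the stars. -/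
abbrev Plane : Type := EuclideanSpace ℝ (Fin 2)

/-- The ambient Euclidean space of the surfaces. -/
abbrev Space : Type := EuclideanSpace ℝ (Fin 3)

/-- The cross product of `ℝ³`. -/
def cross (x y : Space) : Space := WithLp.toLp 2 (crossProduct x.ofLp y.ofLp)

/-- The inclusion of the plane in `ℝ³` as the `e₁ e₂`-plane. -/
def horizontal (x : Plane) : Space := !₂[x 0, x 1, 0]

/-- The third standard basis vector of `ℝ³`. -/
def e₃ : Space := !₂[0, 0, 1]

/-! ### Functions of two variables -/

/-- The (possibly one-sided) partial derivative `f_u` on a set `D` of the `(u, v)`-plane. -/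
def partialU {E : Type*} [NormedAddCommGroup E] [NormedSpace ℝ E]
    (D : Set (ℝ × ℝ)) (f : ℝ × ℝ → E) (p : ℝ × ℝ) : E :=
  derivWithin (fun u => f (u, p.2)) {u | (u, p.2) ∈ D} p.1

/-- The (possibly one-sided) partial derivative `f_v` on a set `D` of the `(u, v)`-plane. -/
def partialV {E : Type*} [NormedAddCommGroup E] [NormedSpace ℝ E]
    (D : Set (ℝ × ℝ)) (f : ℝ × ℝ → E) (p : ℝ × ℝ) : E :=
  derivWithin (fun v => f (p.1, v)) {v | (p.1, v) ∈ D} p.2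

/-- `f` has partial derivatives `f_u` and `f_v`, taken within `D`, at the point `p`. -/
def HasPartials {E : Type*} [NormedAddCommGroup E] [NormedSpace ℝ E]
    (D : Set (ℝ × ℝ)) (f : ℝ × ℝ → E) (p : ℝ × ℝ) : Prop :=
  DifferentiableWithinAt ℝ (fun u => f (u, p.2)) {u | (u, p.2) ∈ D} p.1 ∧
    DifferentiableWithinAt ℝ (fun v => f (p.1, v)) {v | (p.1, v) ∈ D} p.2

/-- `f` is of class `C^{1M}` on `D`: it is `C¹` and the mixed second partial derivatives
`f_uv` and `f_vu` exist, are equal and are continuous. -/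
structure IsC1M {E : Type*} [NormedAddCommGroup E] [NormedSpace ℝ E]
    (D : Set (ℝ × ℝ)) (f : ℝ × ℝ → E) : Prop where
  hasPartials : ∀ p ∈ D, HasPartials D f p
  continuousOn : ContinuousOn f D
  continuousOn_u : ContinuousOn (partialU D f) D
  continuousOn_v : ContinuousOn (partialV D f) D
  differentiable_uv : ∀ p ∈ D,
    DifferentiableWithinAt ℝ (fun v => partialU D f (p.1, v)) {v | (p.1, v) ∈ D} p.2
  differentiable_vu : ∀ p ∈ D,
    DifferentiableWithinAt ℝ (fun u => partialV D f (u, p.2)) {u | (u, p.2) ∈ D} p.1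
  mixed_eq : ∀ p ∈ D, partialV D (partialU D f) p = partialU D (partialV D f) p
  continuousOn_uv : ContinuousOn (partialV D (partialU D f)) D

/-! ### Pseudospherical fronts -/

/-- `N : D → S²` is weakly (Lorentz) harmonic: it is `C^{1M}`, `N_u` and `N_v` do not vanish, and
`N_uv = ν N` for some continuous function `ν`. -/
structure IsWeaklyHarmonic (D : Set (ℝ × ℝ)) (N : ℝ × ℝ → Space) : Prop where
  unit : ∀ p ∈ D, ‖N p‖ = 1
  isC1M : IsC1M D N
  regular_u : ∀ p ∈ D, partialU D N p ≠ 0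
  regular_v : ∀ p ∈ D, partialV D N p ≠ 0
  moutard : ∃ ν : ℝ × ℝ → ℝ, ContinuousOn ν D ∧
    ∀ p ∈ D, partialV D (partialU D N) p = ν p • N p

/-- `r : D → ℝ³` is a pseudospherical front with normal `N`: `N` is weakly harmonic and `r` is a
weakly regular `C^{1M}` solution of the Lelieuvre equations
`r_u = N_u × N`, `r_v = - N_v × N`. -/
structure IsPSFront (D : Set (ℝ × ℝ)) (r N : ℝ × ℝ → Space) : Prop where
  harmonic : IsWeaklyHarmonic D N
  isC1M : IsC1M D r
  regular_u : ∀ p ∈ D, partialU D r p ≠ 0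
  regular_v : ∀ p ∈ D, partialV D r p ≠ 0
  lelieuvre_u : ∀ p ∈ D, partialU D r p = cross (partialU D N p) (N p)
  lelieuvre_v : ∀ p ∈ D, partialV D r p = -cross (partialV D N p) (N p)

/-! ### Stars

The data of a star are the angles `α 1, …, α (2m)` and the lengths `l 1, …, l (2m)`; other values
of `α` and `l` are never used. The ray with index `0` is the ray with index `2m`. -/

/-- `β_i = α_1 + ⋯ + α_i`. -/
def rayAngle (α : ℕ → ℝ) (i : ℕ) : ℝ := ∑ j ∈ Finset.Icc 1 i, α j

/-- The unit vector `s_i = cos β_i e₁ + sin β_i e₂`. -/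
def rayDir (α : ℕ → ℝ) (i : ℕ) : Plane :=
  !₂[Real.cos (rayAngle α i), Real.sin (rayAngle α i)]

/-- The length `l_i` of the ray with index `0 ≤ i ≤ 2m`, where `l_0 = l_{2m}`. -/
def rayLength (m : ℕ) (l : ℕ → ℝ) (i : ℕ) : ℝ := if i = 0 then l (2 * m) else l i

/-- The sector `S_i` between the rays `s_{i-1}` and `s_i`, for `1 ≤ i ≤ 2m`. -/
def sector (m : ℕ) (α l : ℕ → ℝ) (i : ℕ) : Set Plane :=
  {x | ∃ c ∈ Ico 0 (rayLength m l (i - 1)), ∃ d ∈ Ico 0 (rayLength m l i),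
    x = c • rayDir α (i - 1) + d • rayDir α i}

/-- The star: the union of its `2m` sectors. -/
def mStar (m : ℕ) (α l : ℕ → ℝ) : Set Plane := ⋃ i ∈ Finset.Icc 1 (2 * m), sector m α l i

/-- The point of the sector `S_i` with asymptotic coordinates `(u, v)`. The coordinate `u` is
measured along the bounding ray of even index, `v` along the bounding ray of odd index. -/
def sectorPoint (α : ℕ → ℝ) (i : ℕ) (p : ℝ × ℝ) : Plane :=
  if Even i then p.1 • rayDir α i + p.2 • rayDir α (i - 1)
  else p.1 • rayDir α (i - 1) + p.2 • rayDir α i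

/-- The range of the asymptotic coordinates `(u, v)` on the sector `S_i`. -/
def sectorRect (m : ℕ) (l : ℕ → ℝ) (i : ℕ) : Set (ℝ × ℝ) :=
  if Even i then Ico 0 (rayLength m l i) ×ˢ Ico 0 (rayLength m l (i - 1))
  else Ico 0 (rayLength m l (i - 1)) ×ˢ Ico 0 (rayLength m l i)

/-! ### Saddles -/

/-- `r : T → ℝ³` is a (uniformly) `C^{1,1}` immersion of the surface `T` with Lipschitz unit normal
field `N`. Here `T` is regarded as a Lipschitz surface without a preferred smooth structure:
the linear coordinates of a star are in general not smooth coordinates of the immersed surface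
across the rays. So it is required that, in suitable bi-Lipschitz local coordinates `e` of `T`,
the map `r` is an immersion with Lipschitz derivative whose tangent planes are orthogonal
to `N`. As `r` is an immersion in these coordinates, any two of them are automatically
related by a `C^{1,1}` change of coordinates. All bounds are uniform on `T`. -/
def IsC11Immersion (T : Set Plane) (r N : Plane → Space) : Prop :=
  ∃ K : ℝ≥0, (∀ x ∈ T, ‖N x‖ = 1) ∧ LipschitzOnWith K N T ∧
    ∀ x ∈ T, ∃ e : OpenPartialHomeomorph Plane Plane,
      x ∈ e.source ∧ e.source ⊆ T ∧
      LipschitzOnWith K e e.source ∧ LipschitzOnWith K e.symm e.target ∧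
      DifferentiableOn ℝ (r ∘ e.symm) e.target ∧
      LipschitzOnWith K (fderiv ℝ (r ∘ e.symm)) e.target ∧
      ∀ y ∈ e.target, ∀ w : Plane,
        ‖w‖ ≤ K * ‖fderiv ℝ (r ∘ e.symm) y w‖ ∧
        ‖fderiv ℝ (r ∘ e.symm) y w‖ ≤ K * ‖w‖ ∧
        inner ℝ (fderiv ℝ (r ∘ e.symm) y w) (N (e.symm y)) = 0

/-- `r` is an `m`-saddle on the star with data `α`, `l`, and `N` is its normal field: `r` is of
class `C^{1,1}`, and on each sector `r` and `N` form a pseudospherical front in the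
asymptotic coordinates of that sector. -/
structure IsSaddle (m : ℕ) (α l : ℕ → ℝ) (r N : Plane → Space) : Prop where
  isC11 : IsC11Immersion (mStar m α l) r N
  isPSFront : ∀ i ∈ Finset.Icc 1 (2 * m),
    IsPSFront (sectorRect m l i) (r ∘ sectorPoint α i) (N ∘ sectorPoint α i)

/-! ### Frenet frames -/

/-- The coefficient matrix of the Frenet-Serret equations with geodesic curvature `κ` and
torsion `τ`. -/
def frenetMatrix (κ τ : ℝ) : Matrix (Fin 3) (Fin 3) ℝ :=
  !![0, κ, 0; -κ, 0, τ; 0, -τ, 0]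

/-- On `[0, l)`, `F` is, an arc-length parametrized Frenet frame with geodesic curvature `κ` and
torsion `τ`. The rows of `F t` are the unit tangent `t`, the vector `N × t` and the normal `N`. -/
def IsFrenetFrame (l : ℝ) (κ : ℝ → ℝ) (τ : ℝ) (F : ℝ → Matrix (Fin 3) (Fin 3) ℝ) : Prop :=
  ∀ t ∈ Ico 0 l, F t ∈ Matrix.specialOrthogonalGroup (Fin 3) ℝ ∧
    ∀ a b, HasDerivWithinAt (fun s => F s a b) ((frenetMatrix (κ t) τ * F t) a b) (Ico 0 l) t

/-- The unit tangent of a frame. -/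
def frameTangent (F : Matrix (Fin 3) (Fin 3) ℝ) : Space := WithLp.toLp 2 (F 0)

/-- The normal of a frame. -/
def frameNormal (F : Matrix (Fin 3) (Fin 3) ℝ) : Space := WithLp.toLp 2 (F 2)

end

/-! On one sector the normal determines the front. Since `N` is a unit field, `N_uv = ν N` forces `ν
= -⟨N_u, N_v⟩`, so `N` solves a Goursat problem whose data on the two axes are the normals of the
Frenet frames along the bounding rays. On a small square this problem is solved by contraction
(`exists_goursat`). The defect `|N|² - 1` solves a linear equation of the same type with zero data,
so the solution stays in the sphere (`norm_eq_one_of_goursat`). As `N_uv` is parallel to `N`, both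
`(N_u × N)_v` and `-(N_v × N)_u` equal `N_u × N_v`. Hence the Lelieuvre equations are compatible,
and `r` is the solution of `r_uv = N_u × N_v` with the prescribed boundary curves
(`exists_isFrontOn`). The torsions `∓1` are exactly what makes these curves satisfy the Lelieuvre
equations on the axes.

The number of rays is even, so the roles of `u` and `v` alternate consistently around the vertex.
Neighbouring sectors carry the same curve and the same normal along their common ray, so the pieces
glue to continuous maps `r` and `N` (`eq_of_mem_cones`).

It remains to see that the glued surface is `C^{1,1}`, although in the linear coordinates of the
star the derivatives transverse to a ray need not match (`exists_ball_isC11Immersion`). The field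
`N` is Lipschitz, because it is so on each of finitely many closed convex pieces, and it is close to
`e₃` near the vertex. At the vertex the horizontal part of each differential is the identity, so the
vertical projection of `r` is a small Lipschitz perturbation of the identity and serves as a chart.
The deviation of `r` from its tangent plane is quadratic, since `dr ⊥ N` on every piece and `N` is
Lipschitz. So in this chart `r` is differentiable everywhere, even on the rays and at the vertex.
Its differential is the graph parametrization of `N^⊥`, a Lipschitz function of `N`. -/

open Metric Filter Topology

noncomputable section

/-! ### Lipschitz maps on finite closed covers -/

/-- A function that is Lipschitz on the pieces of a finite closed cover of a convex set is Lipschitz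
on the whole set, with the same constant. -/
theorem lipschitzOnWith_of_finite_closed_cover {E F ι : Type*} [NormedAddCommGroup E]
    [NormedSpace ℝ E] [NormedAddCommGroup F] (I : Finset ι) {C : ι → Set E} {B : Set E}
    (hB : Convex ℝ B) (hC : ∀ i ∈ I, IsClosed (C i)) (hcov : ∀ x ∈ B, ∃ i ∈ I, x ∈ C i)
    {f : E → F} {K : ℝ≥0} (hf : ∀ i ∈ I, LipschitzOnWith K f (C i ∩ B)) :
    LipschitzOnWith K f B := by
  refine LipschitzOnWith.of_dist_le_mul fun x hx y hy => ?_
  set γ : ℝ → E := fun t => x + t • (y - x) with hγ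
  have hγc : Continuous γ := by fun_prop
  have hγB : ∀ t ∈ Icc (0 : ℝ) 1, γ t ∈ B := fun t ht => hB.add_smul_sub_mem hx hy ht
  have hγd : ∀ s t, dist (γ s) (γ t) = |s - t| * dist x y := by
    intro s t
    rw [dist_eq_norm, dist_eq_norm, norm_sub_rev x y, ← Real.norm_eq_abs, ← norm_smul]
    congr 1
    simp only [hγ]; module
  let A : ι → Set ℝ := fun i => γ ⁻¹' C i ∩ Icc 0 1
  have hA : ∀ i ∈ I, IsClosed (A i) := fun i hi => ((hC i hi).preimage hγc).inter isClosed_Icc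
  have hlip : ∀ i ∈ I, ∀ s ∈ A i, ∀ t ∈ A i,
      dist (f (γ s)) (f (γ t)) ≤ K * (|s - t| * dist x y) := by
    intro i hi s hs t ht
    rw [← hγd]
    exact (hf i hi).dist_le_mul _ ⟨hs.1, hγB s hs.2⟩ _ ⟨ht.1, hγB t ht.2⟩
  have hcont : ContinuousOn (fun t => f (γ t)) (Icc 0 1) := by
    have h := LocallyFinite.continuousOn_iUnion (g := fun t => f (γ t))
      (f := fun i : I => A i) (locallyFinite_of_finite _) (fun i => hA i i.2)
      (fun i => (hf i i.2).continuousOn.comp hγc.continuousOn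
        (fun t ht => ⟨ht.1, hγB t ht.2⟩))
    refine h.mono fun t ht => ?_
    obtain ⟨i, hi, h⟩ := hcov _ (hγB t ht)
    exact mem_iUnion.2 ⟨⟨i, hi⟩, h, ht⟩
  -- It suffices to bound the lower right slopes of the distance travelled from `f (γ 0)` by `K *
  -- dist x y`.
  have key := image_le_of_liminf_slope_right_le_deriv_boundary
    (f := fun t => dist (f (γ t)) (f (γ 0))) (a := 0) (b := 1)
    (fun t ht => (hcont t ht).dist continuousWithinAt_const) (B := fun t => t * (K * dist x y))
    (B' := fun _ => K * dist x y) (by simp) (by fun_prop)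
    (fun t _ => by simpa using ((hasDerivAt_id t).mul_const (K * dist x y)).hasDerivWithinAt) ?_
    (right_mem_Icc.2 zero_le_one)
  · simp only [hγ, one_smul, zero_smul, add_zero, one_mul, add_sub_cancel] at key
    rwa [dist_comm]
  intro t ht r hr
  have hin : ∀ᶠ z in 𝓝[>] t, z ∈ Ioo t 1 := Ioo_mem_nhdsGT ht.2
  -- One of the finitely many pieces is met at times arbitrarily close to `t` from the right. Being
  -- closed it contains `γ t` too, so these slopes are measured inside a single piece.
  obtain ⟨i, hi, hfr⟩ : ∃ i ∈ I, ∃ᶠ z in 𝓝[>] t, z ∈ A i := by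
    by_contra! hcon
    have h1 : ∀ᶠ z in 𝓝[>] t, ∀ i ∈ I, z ∉ A i :=
      (Filter.eventually_all_finset I).2 hcon
    obtain ⟨z, hz, hz'⟩ := (h1.and hin).exists
    have hz01 : z ∈ Icc (0 : ℝ) 1 := ⟨ht.1.trans hz'.1.le, hz'.2.le⟩
    obtain ⟨i, hi, hzi⟩ := hcov _ (hγB z hz01)
    exact hz i hi ⟨hzi, hz01⟩
  have htA : t ∈ A i := (hA i hi).mem_of_frequently_of_tendsto hfr
    (tendsto_id.mono_left nhdsWithin_le_nhds)
  refine (hfr.and_eventually hin).mono fun z hz => lt_of_le_of_lt ?_ hr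
  have hzt : 0 < z - t := sub_pos.2 hz.2.1
  rw [slope_def_field, div_le_iff₀ hzt]
  have h2 := hlip i hi z hz.1 t htA
  rw [abs_of_pos hzt] at h2
  have h3 := dist_triangle (f (γ z)) (f (γ t)) (f (γ 0))
  linarith

/-! ### Planes as graphs over the horizontal plane -/

/-- The orthogonal projection to the `e₁ e₂`-plane. -/
def shadow : Space →L[ℝ] Plane :=
  LinearMap.toContinuousLinearMap
    { toFun := fun x => !₂[x 0, x 1]
      map_add' := fun x y => by ext i; fin_cases i <;> simp
      map_smul' := fun c x => by ext i; fin_cases i <;> simp }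

@[simp] theorem shadow_apply_zero (x : Space) : shadow x 0 = x 0 := rfl

@[simp] theorem shadow_apply_one (x : Space) : shadow x 1 = x 1 := rfl

/-- The linear parametrization of the plane `n^⊥` as a graph over the `e₁ e₂`-plane. -/
def graphMap (n : Space) : Plane →L[ℝ] Space :=
  LinearMap.toContinuousLinearMap
    { toFun := fun w => !₂[w 0, w 1, -(n 0 * w 0 + n 1 * w 1) / n 2]
      map_add' := fun x y => by ext i; fin_cases i <;> simp; ring
      map_smul' := fun c x => by ext i; fin_cases i <;> simp; ring }

theorem graphMap_apply (n : Space) (w : Plane) :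
    graphMap n w = !₂[w 0, w 1, -(n 0 * w 0 + n 1 * w 1) / n 2] := rfl

theorem space_norm_sq (x : Space) : ‖x‖ ^ 2 = x 0 ^ 2 + x 1 ^ 2 + x 2 ^ 2 := by
  rw [EuclideanSpace.real_norm_sq_eq, Fin.sum_univ_three]

theorem plane_norm_sq (x : Plane) : ‖x‖ ^ 2 = x 0 ^ 2 + x 1 ^ 2 := by
  rw [EuclideanSpace.real_norm_sq_eq, Fin.sum_univ_two]

theorem space_inner (x y : Space) : inner ℝ x y = x 0 * y 0 + x 1 * y 1 + x 2 * y 2 := by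
  simp [PiLp.inner_apply, Fin.sum_univ_three, mul_comm]

theorem shadow_graphMap (n : Space) (w : Plane) : shadow (graphMap n w) = w := by
  ext i; fin_cases i <;> rfl

theorem norm_shadow_le (x : Space) : ‖shadow x‖ ≤ ‖x‖ := by
  refine le_of_sq_le_sq ?_ (norm_nonneg _)
  rw [space_norm_sq, plane_norm_sq, shadow_apply_zero, shadow_apply_one]
  nlinarith [sq_nonneg (x 2)]

theorem inner_graphMap {n : Space} (hn : n 2 ≠ 0) (w : Plane) :
    inner ℝ (graphMap n w) n = 0 := by
  rw [space_inner, graphMap_apply]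
  simp
  field_simp
  ring

/-- The two vectors have the same shadow, so they differ by a multiple of `e₃`; pairing with `n`
gives the factor. -/
theorem sub_graphMap_shadow {n : Space} (hn : n 2 ≠ 0) (x : Space) :
    x - graphMap n (shadow x) = (inner ℝ x n / n 2) • e₃ := by
  rw [space_inner, graphMap_apply]
  ext i
  fin_cases i
  · simp [e₃]
  · simp [e₃]
  · simp [e₃]
    field_simp
    ring

theorem norm_e₃ : ‖e₃‖ = 1 := by
  have : ‖e₃‖ ^ 2 = 1 := by rw [space_norm_sq]; simp [e₃]
  nlinarith [norm_nonneg e₃]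

theorem abs_space_apply_le (x : Space) (i : Fin 3) : |x i| ≤ ‖x‖ := by
  simpa using PiLp.norm_apply_le x i

theorem abs_plane_apply_le (x : Plane) (i : Fin 2) : |x i| ≤ ‖x‖ := by
  simpa using PiLp.norm_apply_le x i

theorem le_norm_graphMap (n : Space) (w : Plane) : ‖w‖ ≤ ‖graphMap n w‖ := by
  simpa only [shadow_graphMap] using norm_shadow_le (graphMap n w)

/-- Only the third components differ, through the slopes `n i / n 2`. Each slope changes by at most
`2 / (1/4) = 8` times `‖n - k‖`, and there are two of them. -/
theorem norm_graphMap_sub_le {n k : Space} (hn : ‖n‖ = 1) (hn2 : 1 / 2 ≤ n 2) (hk2 : 1 / 2 ≤ k 2) :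
    ‖graphMap n - graphMap k‖ ≤ 16 * ‖n - k‖ := by
  refine ContinuousLinearMap.opNorm_le_bound _ (by positivity) fun w => ?_
  have hn0 : n 2 ≠ 0 := by linarith
  have hk0 : k 2 ≠ 0 := by linarith
  have key : ∀ i, |n i / n 2 - k i / k 2| ≤ 8 * ‖n - k‖ := by
    intro i
    have h1 : n i / n 2 - k i / k 2 = (n 2 * (n i - k i) - n i * (n 2 - k 2)) / (n 2 * k 2) := by
      field_simp; ring
    rw [h1, abs_div, div_le_iff₀ (by positivity)]
    have h2 : 1 / 4 ≤ |n 2 * k 2| := by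
      rw [abs_of_nonneg (by positivity)]; nlinarith
    have h3 : |n 2 * (n i - k i) - n i * (n 2 - k 2)| ≤ 2 * ‖n - k‖ := by
      refine (abs_sub _ _).trans ?_
      rw [abs_mul, abs_mul]
      have a1 := abs_space_apply_le n 2
      have a2 := abs_space_apply_le n i
      have a3 := abs_space_apply_le (n - k) 2
      have a4 := abs_space_apply_le (n - k) i
      rw [hn] at a1 a2
      have b1 : |n 2| * |n i - k i| ≤ 1 * ‖n - k‖ := by gcongr; exact a4
      have b2 : |n i| * |n 2 - k 2| ≤ 1 * ‖n - k‖ := by gcongr; exact a3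
      linarith
    nlinarith [norm_nonneg (n - k)]
  have h1 : (graphMap n - graphMap k) w
      = (-((n 0 / n 2 - k 0 / k 2) * w 0 + (n 1 / n 2 - k 1 / k 2) * w 1)) • e₃ := by
    rw [sub_apply, graphMap_apply, graphMap_apply]
    ext i
    fin_cases i
    · simp [e₃]
    · simp [e₃]
    · simp [e₃]
      ring
  rw [h1, norm_smul, norm_e₃, mul_one, norm_neg, Real.norm_eq_abs]
  refine (abs_add_le _ _).trans ?_
  rw [abs_mul, abs_mul]
  have c0 := abs_plane_apply_le w 0
  have c1 := abs_plane_apply_le w 1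
  have b1 : |n 0 / n 2 - k 0 / k 2| * |w 0| ≤ 8 * ‖n - k‖ * ‖w‖ := by
    gcongr; exact key 0
  have b2 : |n 1 / n 2 - k 1 / k 2| * |w 1| ≤ 8 * ‖n - k‖ * ‖w‖ := by
    gcongr; exact key 1
  linarith

/-- Comparison with the isometry `graphMap e₃`: the constant is `1 + 16 * 2`, as `‖n - e₃‖ ≤ 2`. -/
theorem norm_graphMap_le {n : Space} (hn : ‖n‖ = 1) (hn2 : 1 / 2 ≤ n 2) (w : Plane) :
    ‖graphMap n w‖ ≤ 33 * ‖w‖ := by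
  have h1 : ‖graphMap e₃ w‖ = ‖w‖ := by
    refine (sq_eq_sq₀ (norm_nonneg _) (norm_nonneg _)).1 ?_
    rw [space_norm_sq, plane_norm_sq, graphMap_apply]
    simp [e₃]
  have h2 : 1 / 2 ≤ e₃ 2 := by simp [e₃]; norm_num
  have h3 : ‖n - e₃‖ ≤ 2 := (norm_sub_le _ _).trans (by rw [hn, norm_e₃]; norm_num)
  have h4 := (graphMap n - graphMap e₃).le_opNorm w
  have h5 := norm_graphMap_sub_le hn hn2 h2
  rw [sub_apply] at h4
  have h6 := norm_sub_norm_le (graphMap n w) (graphMap e₃ w)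
  nlinarith [norm_nonneg w]

theorem norm_sub_graphMap_shadow_le {n : Space} (hn2 : 1 / 2 ≤ n 2) (x : Space) :
    ‖x - graphMap n (shadow x)‖ ≤ 2 * |inner ℝ x n| := by
  have hn0 : 0 < n 2 := by linarith
  rw [sub_graphMap_shadow hn0.ne', norm_smul, norm_e₃, mul_one, Real.norm_eq_abs, abs_div,
    abs_of_pos hn0, div_le_iff₀ hn0]
  nlinarith [abs_nonneg (inner ℝ x n)]

/-! ### Gluing `C¹` immersions with a common normal -/

/-- A function that agrees with finitely many `C¹` functions on the convex pieces of a closed cover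
is Lipschitz where the derivatives of these functions are bounded. -/
theorem lipschitzOnWith_of_pieces {E F ι : Type*} [NormedAddCommGroup E]
    [NormedSpace ℝ E] [NormedAddCommGroup F] [NormedSpace ℝ F] (I : Finset ι) {C : ι → Set E}
    {B : Set E} (hB : Convex ℝ B) (hC : ∀ i ∈ I, IsClosed (C i)) (hCc : ∀ i ∈ I, Convex ℝ (C i))
    (hcov : ∀ x, ∃ i ∈ I, x ∈ C i) {f : E → F} {g : ι → E → F} {g' : ι → E → E →L[ℝ] F} {K : ℝ≥0}
    (hfg : ∀ i ∈ I, EqOn f (g i) (C i))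
    (hg : ∀ i ∈ I, ∀ x ∈ C i ∩ B, HasFDerivAt (g i) (g' i x) x)
    (hK : ∀ i ∈ I, ∀ x ∈ C i ∩ B, ‖g' i x‖ ≤ K) : LipschitzOnWith K f B := by
  refine lipschitzOnWith_of_finite_closed_cover I hB hC (fun x _ => hcov x) fun i hi => ?_
  have h := ((hCc i hi).inter hB).lipschitzOnWith_of_nnnorm_hasFDerivWithin_le
    (fun x hx => (hg i hi x hx).hasFDerivWithinAt) (fun x hx => hK i hi x hx)
  intro x hx y hy
  rw [hfg i hi hx.1, hfg i hi hy.1]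
  exact h hx hy

/-- A map that near the origin is pieced together from `C¹` immersions with a common unit normal
field, whose tangent planes at the origin are horizontal, is a `C^{1,1}` immersion there. -/
theorem exists_ball_isC11Immersion {ι : Type*} (I : Finset ι) {C : ι → Set Plane}
    (hC : ∀ i ∈ I, IsClosed (C i)) (hCc : ∀ i ∈ I, Convex ℝ (C i))
    (hcov : ∀ x, ∃ i ∈ I, x ∈ C i) {r N : Plane → Space} {R M : ι → Plane → Space}
    (hR : ∀ i ∈ I, ContDiff ℝ 1 (R i)) (hM : ∀ i ∈ I, ContDiff ℝ 1 (M i))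
    (hrR : ∀ i ∈ I, EqOn r (R i) (C i)) (hNM : ∀ i ∈ I, EqOn N (M i) (C i))
    {ρ : ℝ} (hρ : 0 < ρ) (hunit : ∀ x ∈ ball 0 ρ, ‖N x‖ = 1)
    (horth : ∀ i ∈ I, ∀ x ∈ C i ∩ ball 0 ρ, ∀ w, inner ℝ (fderiv ℝ (R i) x w) (N x) = 0)
    (hN0 : N 0 = e₃) (hR0 : ∀ i ∈ I, ∀ w, shadow (fderiv ℝ (R i) 0 w) = w) :
    ∃ ρ' > 0, ∀ T : Set Plane, IsOpen T → T ⊆ ball 0 ρ' → IsC11Immersion T r N := by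
  -- The bounds are strict at the origin so that they persist nearby; `1 ≤ A` lets `A` absorb
  -- absolute constants at the end.
  obtain ⟨A, hA1, hA⟩ : ∃ A : ℝ≥0, 1 ≤ A ∧
      ∀ i ∈ I, ‖fderiv ℝ (R i) 0‖ < A ∧ ‖fderiv ℝ (M i) 0‖ < A := by
    refine ⟨1 + ∑ i ∈ I, (‖fderiv ℝ (R i) 0‖₊ + ‖fderiv ℝ (M i) 0‖₊), by simp, fun i hi => ?_⟩
    have h := Finset.single_le_sum (f := fun i => ‖fderiv ℝ (R i) 0‖₊ + ‖fderiv ℝ (M i) 0‖₊)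
      (fun _ _ => zero_le) hi
    have h' := NNReal.coe_le_coe.2 h
    push_cast at h' ⊢
    constructor <;> linarith [norm_nonneg (fderiv ℝ (R i) 0), norm_nonneg (fderiv ℝ (M i) 0)]
  obtain ⟨ρ₁, hρ₁, hder⟩ : ∃ ρ₁ > 0, ∀ x ∈ ball (0 : Plane) ρ₁, ∀ i ∈ I,
      ‖fderiv ℝ (R i) x‖ < A ∧ ‖fderiv ℝ (M i) x‖ < A ∧
      ‖shadow ∘L fderiv ℝ (R i) x - ContinuousLinearMap.id ℝ Plane‖ < 1 / 2 := by
    refine Metric.eventually_nhds_iff_ball.1 ((Filter.eventually_all_finset I).2 fun i hi => ?_)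
    have cR : Continuous (fderiv ℝ (R i)) := (hR i hi).continuous_fderiv one_ne_zero
    have cM : Continuous (fderiv ℝ (M i)) := (hM i hi).continuous_fderiv one_ne_zero
    refine (cR.norm.continuousAt.eventually_lt_const (hA i hi).1).and
      ((cM.norm.continuousAt.eventually_lt_const (hA i hi).2).and ?_)
    have c3 : Continuous fun x =>
        ‖shadow ∘L fderiv ℝ (R i) x - ContinuousLinearMap.id ℝ Plane‖ :=
      ((continuous_const.clm_comp cR).sub continuous_const).norm
    refine c3.continuousAt.eventually_lt_const ?_
    have : shadow ∘L fderiv ℝ (R i) 0 - ContinuousLinearMap.id ℝ Plane = 0 := by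
      ext1 w
      simp [hR0 i hi w]
    simp [this]
  have hA0 : (0 : ℝ) < A := lt_of_lt_of_le one_pos (by exact_mod_cast hA1)
  -- On the ball of radius `1 / (2A)` the `A`-Lipschitz field `N` stays within `1/2` of `e₃`, so its
  -- third component is at least `1/2`.
  set ρ' := min ρ (min ρ₁ (1 / (2 * A))) with hρ'
  have hρ'0 : 0 < ρ' := by positivity
  set B : Set Plane := ball 0 ρ' with hBdef
  have hBρ : B ⊆ ball 0 ρ := ball_subset_ball (min_le_left _ _)
  have hBρ₁ : B ⊆ ball 0 ρ₁ := ball_subset_ball ((min_le_right _ _).trans (min_le_left _ _))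
  have hBconv : Convex ℝ B := convex_ball 0 ρ'
  have hRd : ∀ i ∈ I, ∀ x, HasFDerivAt (R i) (fderiv ℝ (R i) x) x := fun i hi x =>
    ((hR i hi).differentiable one_ne_zero x).hasFDerivAt
  have hMd : ∀ i ∈ I, ∀ x, HasFDerivAt (M i) (fderiv ℝ (M i) x) x := fun i hi x =>
    ((hM i hi).differentiable one_ne_zero x).hasFDerivAt
  have hNlip : LipschitzOnWith A N B := lipschitzOnWith_of_pieces I hBconv hC hCc hcov hNM
    (fun i hi x _ => hMd i hi x) (fun i hi x hx => (hder x (hBρ₁ hx.2) i hi).2.1.le)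
  have h0B : (0 : Plane) ∈ B := mem_ball_self hρ'0
  have hN2 : ∀ x ∈ B, 1 / 2 ≤ N x 2 := by
    intro x hx
    have h1 := hNlip.dist_le_mul x hx 0 h0B
    rw [hN0, dist_eq_norm] at h1
    have h2 := abs_space_apply_le (N x - e₃) 2
    have h3 : dist x 0 < 1 / (2 * A) :=
      lt_of_lt_of_le hx ((min_le_right _ _).trans (min_le_right _ _))
    rw [lt_div_iff₀ (by positivity)] at h3
    have h4 : (N x - e₃) 2 = N x 2 - 1 := by simp [e₃]
    rw [h4, abs_le] at h2
    linarith [h2.1]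
  -- The map `shadow ∘ r - id` is glued from pieces with derivative at most `1/2`, so `shadow ∘ r`
  -- is injective with open image: it is the chart `e` below.
  have happrox : ApproximatesLinearOn (fun x => shadow (r x))
      ((ContinuousLinearEquiv.refl ℝ Plane : Plane ≃L[ℝ] Plane) : Plane →L[ℝ] Plane) B (1 / 2) := by
    rw [ApproximatesLinearOn.approximatesLinearOn_iff_lipschitzOnWith]
    refine lipschitzOnWith_of_pieces I hBconv hC hCc hcov (g := fun i x => shadow (R i x) - x)
      (g' := fun i x => shadow ∘L fderiv ℝ (R i) x - ContinuousLinearMap.id ℝ Plane) ?_ ?_ ?_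
    · intro i hi x hx
      simp [hrR i hi hx]
    · intro i hi x _
      exact (shadow.hasFDerivAt.comp x (hRd i hi x)).sub (hasFDerivAt_id x)
    · intro i hi x hx
      simpa using (hder x (hBρ₁ hx.2) i hi).2.2.le
  -- At `z`, the derivative of `⟨N x, r⟩` is `⟨N x - N z, dr⟩` because `dr ⊥ N z`. On the ball of
  -- radius `d` about `x` it is at most `(A d) A`; over a distance `d` this yields `A² d²`.
  have hquad : ∀ x ∈ B, ∀ y ∈ B, |inner ℝ (r y - r x) (N x)| ≤ A * A * dist y x ^ 2 := by
    intro x hx y hy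
    obtain ⟨d, hd⟩ : ∃ d : ℝ≥0, (d : ℝ) = dist y x := ⟨⟨_, dist_nonneg⟩, rfl⟩
    have hlip : LipschitzOnWith (A * (A * d)) (fun z => inner ℝ (N x) (r z))
        (B ∩ closedBall x d) := by
      refine lipschitzOnWith_of_pieces I (hBconv.inter (convex_closedBall _ _)) hC hCc hcov
        (g := fun i z => inner ℝ (N x) (R i z))
        (g' := fun i z => innerSL ℝ (N x) ∘L fderiv ℝ (R i) z) ?_ ?_ ?_
      · intro i hi z hz
        simp [hrR i hi hz]
      · intro i hi z _
        exact (innerSL ℝ (N x)).hasFDerivAt.comp z (hRd i hi z)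
      · intro i hi z hz
        refine ContinuousLinearMap.opNorm_le_bound _ (by positivity) fun w => ?_
        have h1 : (innerSL ℝ (N x) ∘L fderiv ℝ (R i) z) w
            = inner ℝ (N x - N z) (fderiv ℝ (R i) z w) := by
          rw [inner_sub_left, real_inner_comm _ (N z), horth i hi z ⟨hz.1, hBρ hz.2.1⟩, sub_zero]
          rfl
        rw [h1]
        refine (norm_inner_le_norm _ _).trans ?_
        have h2 : ‖N x - N z‖ ≤ A * d := by
          rw [← dist_eq_norm]
          refine (hNlip.dist_le_mul x hx z hz.2.1).trans ?_
          gcongr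
          rw [dist_comm]; exact hz.2.2
        have h3 : ‖fderiv ℝ (R i) z w‖ ≤ A * ‖w‖ :=
          (ContinuousLinearMap.le_opNorm _ _).trans
            (by gcongr; exact (hder z (hBρ₁ hz.2.1) i hi).1.le)
        calc ‖N x - N z‖ * ‖fderiv ℝ (R i) z w‖ ≤ (A * d) * (A * ‖w‖) := by gcongr
          _ = _ := by push_cast; ring
    have h := hlip.dist_le_mul y ⟨hy, mem_closedBall.2 hd.ge⟩ x ⟨hx, mem_closedBall_self d.2⟩
    rw [real_inner_comm, inner_sub_right, ← Real.dist_eq]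
    refine h.trans (le_of_eq ?_)
    push_cast
    rw [hd]
    ring
  refine ⟨ρ', hρ'0, fun T hTo hTB => ?_⟩
  have hc : Subsingleton Plane ∨
      (1 / 2 : ℝ≥0) < ‖((ContinuousLinearEquiv.refl ℝ Plane).symm : Plane →L[ℝ] Plane)‖₊⁻¹ := by
    right
    have h1 : ‖((ContinuousLinearEquiv.refl ℝ Plane).symm : Plane →L[ℝ] Plane)‖₊ = 1 :=
      NNReal.eq ContinuousLinearMap.norm_id
    rw [h1, inv_one]
    exact NNReal.half_lt_self one_ne_zero
  have happT := happrox.mono_set hTB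
  let e : OpenPartialHomeomorph Plane Plane := happT.toOpenPartialHomeomorph _ _ hc hTo
  have hes : e.source = T := rfl
  have hecoe : ∀ x, e x = shadow (r x) := fun x => rfl
  have hexp : ∀ x ∈ T, ∀ y ∈ T, dist (e x - e y) (x - y) ≤ 1 / 2 * dist x y := by
    intro x hx y hy
    have h := happT x hx y hy
    rw [dist_eq_norm, dist_eq_norm]
    exact h
  have heup : ∀ x ∈ T, ∀ y ∈ T, dist (e x) (e y) ≤ 2 * dist x y := by
    intro x hx y hy
    have h := hexp x hx y hy
    rw [dist_eq_norm] at h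
    have h2 := norm_le_norm_add_norm_sub' (e x - e y) (x - y)
    rw [← dist_eq_norm, ← dist_eq_norm] at h2
    have := dist_nonneg (x := x) (y := y)
    linarith
  have helow : ∀ x ∈ T, ∀ y ∈ T, dist x y ≤ 2 * dist (e x) (e y) := by
    intro x hx y hy
    have h := hexp x hx y hy
    rw [dist_eq_norm, norm_sub_rev] at h
    have h2 := norm_le_norm_add_norm_sub' (x - y) (e x - e y)
    rw [← dist_eq_norm, ← dist_eq_norm (e x)] at h2
    linarith
  have hsym : ∀ y ∈ e.target, e.symm y ∈ T := fun y hy => e.map_target hy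
  have hsymlip : ∀ y ∈ e.target, ∀ z ∈ e.target, dist (e.symm y) (e.symm z) ≤ 2 * dist y z := by
    intro y hy z hz
    have h := helow _ (hsym y hy) _ (hsym z hz)
    rwa [e.right_inv hy, e.right_inv hz] at h
  -- In the chart the shadow of the increment of `r` is exactly `z - y`, so the error of the
  -- linearization is governed by the normal component. It is at most `2 A² (2 |z - y|)² = 8 A² |z -
  -- y|²`.
  have hfd : ∀ y ∈ e.target, HasFDerivAt (r ∘ e.symm) (graphMap (N (e.symm y))) y := by
    intro y hy
    rw [hasFDerivAt_iff_isLittleO, Asymptotics.isLittleO_iff]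
    intro c hc0
    have hev1 : ∀ᶠ z in 𝓝 y, z ∈ e.target := e.open_target.mem_nhds hy
    have hev2 : ∀ᶠ z in 𝓝 y, dist z y < c / (8 * (A * A)) :=
      Metric.ball_mem_nhds y (by positivity)
    filter_upwards [hev1, hev2] with z hz hzd
    have hx := hTB (hsym y hy)
    have hx' := hTB (hsym z hz)
    have h1 : shadow (r (e.symm z) - r (e.symm y)) = z - y := by
      rw [map_sub, ← hecoe, ← hecoe, e.right_inv hy, e.right_inv hz]
    have h2 := norm_sub_graphMap_shadow_le (hN2 _ hx) (r (e.symm z) - r (e.symm y))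
    rw [h1] at h2
    refine h2.trans ?_
    have h3 := hquad _ hx _ hx'
    have h4 := hsymlip z hz y hy
    rw [lt_div_iff₀ (by positivity)] at hzd
    rw [← dist_eq_norm z y]
    have h5 : dist (e.symm z) (e.symm y) ^ 2 ≤ (2 * dist z y) ^ 2 := by gcongr
    have h6 : A * A * dist (e.symm z) (e.symm y) ^ 2 ≤ A * A * (2 * dist z y) ^ 2 := by gcongr
    have h7 : dist z y * (8 * (A * A)) * dist z y ≤ c * dist z y := by gcongr
    linarith
  have hA4 : (1 : ℝ) ≤ A := by exact_mod_cast hA1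
  -- One constant for all bounds: `2` for the chart and its inverse, `16 * A * 2` for the Lipschitz
  -- derivative, `33` for its norm.
  refine ⟨33 * A, fun x hx => hunit x (hBρ (hTB hx)), ?_, fun x hx => ⟨e, hx, hes.subset, ?_, ?_,
    fun y hy => (hfd y hy).differentiableAt.differentiableWithinAt, ?_, ?_⟩⟩
  · exact (hNlip.mono hTB).weaken (le_mul_of_one_le_left zero_le (by norm_num))
  · refine LipschitzOnWith.of_dist_le_mul fun x hx y hy => (heup x hx y hy).trans ?_
    push_cast
    gcongr
    linarith
  · refine LipschitzOnWith.of_dist_le_mul fun x hx y hy => (hsymlip x hx y hy).trans ?_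
    push_cast
    gcongr
    linarith
  · refine LipschitzOnWith.of_dist_le_mul fun y hy z hz => ?_
    have hx := hTB (hsym y hy)
    have hx' := hTB (hsym z hz)
    rw [(hfd y hy).fderiv, (hfd z hz).fderiv, dist_eq_norm]
    have h1 := norm_graphMap_sub_le (hunit _ (hBρ hx)) (hN2 _ hx) (hN2 _ hx')
    have h2 := hNlip.dist_le_mul _ hx _ hx'
    have h3 := hsymlip y hy z hz
    rw [← dist_eq_norm (N _)] at h1
    push_cast
    have h4 : A * dist (e.symm y) (e.symm z) ≤ A * (2 * dist y z) := by gcongr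
    have h5 : 0 ≤ A * dist y z := by positivity
    linarith
  · intro y hy w
    have hx := hTB (hsym y hy)
    rw [(hfd y hy).fderiv]
    have h1 := le_norm_graphMap (N (e.symm y)) w
    have h2 := norm_graphMap_le (hunit _ (hBρ hx)) (hN2 _ hx) w
    push_cast
    refine ⟨h1.trans (le_mul_of_one_le_left (norm_nonneg _) (by linarith)), h2.trans ?_,
      inner_graphMap (by linarith [hN2 _ hx]) w⟩
    gcongr
    linarith

/-! ### Frenet frames with given curvature and torsion -/

/-- Local existence for linear differential equations. -/
theorem exists_hasDerivWithinAt_linear {E : Type*} [NormedAddCommGroup E] [NormedSpace ℝ E]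
    [CompleteSpace E] {A : ℝ → E →L[ℝ] E} {c : ℝ} (hc : 0 < c) (hA : ContinuousOn A (Icc 0 c))
    (x₀ : E) : ∃ η ∈ Ioc 0 c, ∃ x : ℝ → E, x 0 = x₀ ∧
      ∀ t ∈ Icc 0 η, HasDerivWithinAt x (A t (x t)) (Icc 0 η) t := by
  obtain ⟨k, hk⟩ := isCompact_Icc.exists_bound_of_continuousOn hA
  have hk0 : 0 ≤ k := (norm_nonneg _).trans (hk 0 (left_mem_Icc.2 hc.le))
  lift k to ℝ≥0 using hk0
  -- `b` bounds the speed on the unit ball about `x₀`, and `η ≤ 1 / (b + 1)` is too short a time to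
  -- leave that ball.
  set b : ℝ≥0 := k * (‖x₀‖₊ + 1) with hb
  set η : ℝ := min c (1 / (b + 1)) with hη
  have hη0 : 0 < η := lt_min hc (by positivity)
  have hsub : Icc 0 η ⊆ Icc 0 c := Icc_subset_Icc_right (min_le_left _ _)
  have hpl : IsPicardLindelof (fun t x => A t x) (⟨0, left_mem_Icc.2 hη0.le⟩ : Icc 0 η) x₀ 1 0 b k
      := by
    refine ⟨fun t ht => ?_, fun x _ => (hA.mono hsub).clm_apply continuousOn_const,
      fun t ht x hx => ?_, ?_⟩
    · exact ((A t).lipschitz.weaken (hk t (hsub ht))).lipschitzOnWith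
    · refine ((A t).le_opNorm x).trans ?_
      have h1 : ‖x‖ ≤ ‖x₀‖ + 1 := by
        have := norm_le_norm_add_norm_sub' x x₀
        rw [mem_closedBall, dist_eq_norm] at hx
        push_cast at hx
        linarith
      rw [hb]
      push_cast
      gcongr
      exact hk t (hsub ht)
    · simp only [sub_zero, sub_self, NNReal.coe_one, NNReal.coe_zero]
      rw [max_eq_left hη0.le]
      have h1 : η ≤ 1 / (b + 1) := min_le_right _ _
      rw [le_div_iff₀ (by positivity)] at h1
      linarith
  obtain ⟨x, hx0, hx⟩ := hpl.exists_eq_forall_mem_Icc_hasDerivWithinAt₀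
  exact ⟨η, ⟨hη0, min_le_left _ _⟩, x, hx0, hx⟩

/-- Left multiplication by a matrix, as a continuous linear map. -/
def leftMul (A : Matrix (Fin 3) (Fin 3) ℝ) : (Fin 3 → Fin 3 → ℝ) →L[ℝ] (Fin 3 → Fin 3 → ℝ) :=
  LinearMap.toContinuousLinearMap
    { toFun := fun x a b => (A * Matrix.of x) a b
      map_add' := fun x y => by ext a b; simp [Matrix.mul_apply, mul_add, Finset.sum_add_distrib]
      map_smul' := fun c x => by
        ext a b
        simp [Matrix.mul_apply, Finset.mul_sum, mul_left_comm] }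

/-- Local existence of frames with given geodesic curvature and torsion. -/
theorem exists_frenetFrame {κ : ℝ → ℝ} {c : ℝ} (hc : 0 < c) (hκ : ContinuousOn κ (Icc 0 c)) (τ : ℝ)
    {F₀ : Matrix (Fin 3) (Fin 3) ℝ} (hF₀ : F₀ ∈ Matrix.specialOrthogonalGroup (Fin 3) ℝ) :
    ∃ η ∈ Ioc 0 c, ∃ F : ℝ → Matrix (Fin 3) (Fin 3) ℝ, F 0 = F₀ ∧
      ∀ t ∈ Icc 0 η, F t ∈ Matrix.specialOrthogonalGroup (Fin 3) ℝ ∧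
        ∀ a b, HasDerivWithinAt (fun s => F s a b) ((frenetMatrix (κ t) τ * F t) a b)
          (Icc 0 η) t := by
  have hA : ContinuousOn (fun t => κ t • leftMul (frenetMatrix 1 0) + τ • leftMul (frenetMatrix 0 1))
      (Icc 0 c) := (hκ.smul continuousOn_const).add continuousOn_const
  obtain ⟨η, hη, x, hx0, hx⟩ := exists_hasDerivWithinAt_linear hc hA F₀
  let F : ℝ → Matrix (Fin 3) (Fin 3) ℝ := fun t => Matrix.of (x t)
  have hF : ∀ t ∈ Icc 0 η, ∀ a b, HasDerivWithinAt (fun s => F s a b)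
      ((frenetMatrix (κ t) τ * F t) a b) (Icc 0 η) t := by
    intro t ht a b
    have h := hasDerivWithinAt_pi.1 (hasDerivWithinAt_pi.1 (hx t ht) a) b
    refine h.congr_deriv ?_
    change κ t * (frenetMatrix 1 0 * F t) a b + τ * (frenetMatrix 0 1 * F t) a b = _
    simp only [Matrix.mul_apply, Fin.sum_univ_three]
    fin_cases a <;> simp [frenetMatrix]
  have hcont : ∀ a b, ContinuousOn (fun s => F s a b) (Icc 0 η) := fun a b t ht =>
    (hF t ht a b).continuousWithinAt
  have hF0 : F 0 = F₀ := hx0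
  rw [Matrix.mem_specialOrthogonalGroup_iff, Matrix.mem_orthogonalGroup_iff'] at hF₀
  -- The coefficient matrix is skew, so `Fᵀ F` is a first integral.
  have horth : ∀ t ∈ Icc 0 η, (F t).transpose * F t = 1 := by
    intro t ht
    ext b d
    have hder : ∀ s ∈ Icc 0 η, HasDerivWithinAt
        (fun s => F s 0 b * F s 0 d + F s 1 b * F s 1 d + F s 2 b * F s 2 d) 0 (Icc 0 η) s := by
      intro s hs
      refine ((((hF s hs 0 b).mul (hF s hs 0 d)).add ((hF s hs 1 b).mul (hF s hs 1 d))).add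
        ((hF s hs 2 b).mul (hF s hs 2 d))).congr_deriv ?_
      simp [Matrix.mul_apply, Fin.sum_univ_three, frenetMatrix]
      ring
    have hconst := constant_of_has_deriv_right_zero
      (fun s hs => (hder s hs).continuousWithinAt)
      (fun s hs => (hder s (Ico_subset_Icc_self hs)).mono_of_mem_nhdsWithin
        (Icc_mem_nhdsGE_of_mem hs)) t ht
    have h0 := congrFun (congrFun hF₀.1 b) d
    rw [← hF0] at h0
    simp only [Matrix.mul_apply, Fin.sum_univ_three, Matrix.transpose_apply] at h0 ⊢
    rw [hconst, h0]
  have hdetc : ContinuousOn (fun t => (F t).det) (Icc 0 η) := by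
    simp only [Matrix.det_fin_three]
    fun_prop
  -- The determinant is continuous with values `±1`, so it keeps its initial value `1`.
  have hdet : ∀ t ∈ Icc 0 η, (F t).det = 1 := by
    intro t ht
    have hsq : ∀ s ∈ Icc 0 η, (F s).det = 1 ∨ (F s).det = -1 := by
      intro s hs
      have h := congrArg Matrix.det (horth s hs)
      rw [Matrix.det_mul, Matrix.det_transpose, Matrix.det_one] at h
      exact mul_self_eq_one_iff.1 h
    rcases hsq t ht with h | h
    · exact h
    · have h0 : (F 0).det = 1 := by rw [hF0]; exact hF₀.2
      obtain ⟨s, hs, hs0⟩ := isPreconnected_Icc.intermediate_value ht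
        (left_mem_Icc.2 hη.1.le) hdetc (show (0 : ℝ) ∈ Icc _ _ by simp only [h, h0]; norm_num)
      rcases hsq s hs with h' | h' <;> norm_num [h'] at hs0
  refine ⟨η, hη, F, hF0, fun t ht => ⟨?_, hF t ht⟩⟩
  rw [Matrix.mem_specialOrthogonalGroup_iff, Matrix.mem_orthogonalGroup_iff']
  exact ⟨horth t ht, hdet t ht⟩

/-! ### Cross products and asymptotic boundary curves -/

theorem cross_apply_zero (x y : Space) : cross x y 0 = x 1 * y 2 - x 2 * y 1 := by
  simp [cross, cross_apply]

theorem cross_apply_one (x y : Space) : cross x y 1 = x 2 * y 0 - x 0 * y 2 := by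
  simp [cross, cross_apply]

theorem cross_apply_two (x y : Space) : cross x y 2 = x 0 * y 1 - x 1 * y 0 := by
  simp [cross, cross_apply]

/-- In a positively oriented orthonormal frame `(T, N × T, N)`, the cross product of the last two
vectors is the first. -/
theorem cross_row_one_row_two {F : Matrix (Fin 3) (Fin 3) ℝ}
    (hF : F ∈ Matrix.specialOrthogonalGroup (Fin 3) ℝ) :
    cross (WithLp.toLp 2 (F 1)) (frameNormal F) = frameTangent F := by
  rw [Matrix.mem_specialOrthogonalGroup_iff, Matrix.mem_orthogonalGroup_iff] at hF
  -- Inverse and adjugate agree for determinant `1`; the first column of the adjugate consists of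
  -- the components of the cross product of the last two rows.
  have h1 : F.adjugate = F.transpose := by
    have h2 : F.transpose * (F * F.adjugate) = F.transpose := by
      rw [Matrix.mul_adjugate, hF.2, one_smul, mul_one]
    rw [← h2, ← Matrix.mul_assoc, (mul_eq_one_comm.1 hF.1 : F.transpose * F = 1), one_mul]
  rw [Matrix.adjugate_fin_three] at h1
  have e0 := congrFun (congrFun h1 0) 0
  have e1 := congrFun (congrFun h1 1) 0
  have e2 := congrFun (congrFun h1 2) 0
  simp at e0 e1 e2
  ext i
  fin_cases i
  · change cross _ _ 0 = F 0 0
    rw [cross_apply_zero, ← e0]; rfl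
  · change cross _ _ 1 = F 0 1
    rw [cross_apply_one, ← e1]; simp [frameNormal]; ring
  · change cross _ _ 2 = F 0 2
    rw [cross_apply_two, ← e2]; rfl

theorem norm_row_eq_one {F : Matrix (Fin 3) (Fin 3) ℝ}
    (hF : F ∈ Matrix.specialOrthogonalGroup (Fin 3) ℝ) (i : Fin 3) :
    ‖(WithLp.toLp 2 (F i) : Space)‖ = 1 := by
  rw [Matrix.mem_specialOrthogonalGroup_iff, Matrix.mem_orthogonalGroup_iff] at hF
  have h := congrFun (congrFun hF.1 i) i
  simp [Matrix.mul_apply, Fin.sum_univ_three] at h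
  have h2 : ‖(WithLp.toLp 2 (F i) : Space)‖ ^ 2 = 1 := by
    rw [space_norm_sq, ← h]; ring
  nlinarith [norm_nonneg (WithLp.toLp 2 (F i) : Space)]

/-- The frame at the vertex of the ray with direction angle `β`. -/
def vertexFrame (β : ℝ) : Matrix (Fin 3) (Fin 3) ℝ :=
  !![Real.cos β, Real.sin β, 0; -Real.sin β, Real.cos β, 0; 0, 0, 1]

theorem vertexFrame_mem (β : ℝ) :
    vertexFrame β ∈ Matrix.specialOrthogonalGroup (Fin 3) ℝ := by
  have h := Real.sin_sq_add_cos_sq β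
  rw [Matrix.mem_specialOrthogonalGroup_iff, Matrix.mem_orthogonalGroup_iff]
  constructor
  · ext i j
    fin_cases i <;> fin_cases j <;>
      simp [vertexFrame, Matrix.mul_apply, Fin.sum_univ_three] <;> linarith
  · simp [vertexFrame, Matrix.det_fin_three]
    linarith

theorem continuous_cross {X : Type*} [TopologicalSpace X] {f g : X → Space} (hf : Continuous f)
    (hg : Continuous g) : Continuous fun x => cross (f x) (g x) := by
  have h : (fun x => cross (f x) (g x)) = fun x =>
      WithLp.toLp 2 ![f x 1 * g x 2 - f x 2 * g x 1, f x 2 * g x 0 - f x 0 * g x 2,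
        f x 0 * g x 1 - f x 1 * g x 0] := by
    funext x
    ext i
    fin_cases i
    · exact cross_apply_zero _ _
    · exact cross_apply_one _ _
    · exact cross_apply_two _ _
  rw [h]
  refine (PiLp.continuous_toLp 2 _).comp (continuous_pi fun i => ?_)
  fin_cases i <;> simp <;> fun_prop

/-- A boundary curve of a sector: `F` is the frame of the curve `g`, whose normal `p` has the
derivative `a`. The curve `g`, its normal and the derivative are continued beyond `[0, η]`, where
the frame lives. For `σ = 1` it is a curve in the `u`-direction, with torsion `-1`; for `σ = -1` it
is a curve in the `v`-direction, with torsion `1`. -/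
structure IsAsymptoticCurve (κ : ℝ → ℝ) (σ β η : ℝ) (F : ℝ → Matrix (Fin 3) (Fin 3) ℝ)
    (a p g : ℝ → Space) : Prop where
  continuous : Continuous a
  norm_le : ∀ t, ‖a t‖ ≤ 1
  normal_zero : p 0 = e₃
  hasDerivAt_normal : ∀ t, HasDerivAt p (a t) t
  curve_zero : g 0 = 0
  hasDerivAt_curve : ∀ t, HasDerivAt g (σ • cross (a t) (p t)) t
  norm_normal : ∀ t ∈ Icc 0 η, ‖p t‖ = 1
  isFrenetFrame : ∀ l ≤ η, IsFrenetFrame l κ (-σ) F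
  frameNormal_eq : ∀ t ∈ Icc 0 η, frameNormal (F t) = p t
  frameTangent_eq : ∀ t ∈ Icc 0 η, frameTangent (F t) = σ • cross (a t) (p t)
  frameTangent_zero : frameTangent (F 0) = !₂[Real.cos β, Real.sin β, 0]

/-- With torsion `-σ` the last Frenet equation reads `N' = σ (N × T)`. As `σ² = 1`, this gives `T =
σ N' × N`, the Lelieuvre equation along an axis. Freezing the middle row outside `[0, η]` and
integrating continues all data to the whole line, so that only two-sided derivatives occur later. -/
theorem exists_isAsymptoticCurve {κ : ℝ → ℝ} {L : ℝ} (hL : 0 < L) (hκ : ContinuousOn κ (Ico 0 L))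
    {σ : ℝ} (hσ : σ = 1 ∨ σ = -1) (β : ℝ) :
    ∃ η ∈ Ioo 0 L, ∃ F a p g, IsAsymptoticCurve κ σ β η F a p g := by
  have hσ2 : σ * σ = 1 := by rcases hσ with rfl | rfl <;> norm_num
  obtain ⟨η, hη, F, hF0, hF⟩ := exists_frenetFrame (half_pos hL)
    (hκ.mono (Icc_subset_Ico_right (half_lt_self hL))) (-σ) (vertexFrame_mem β)
  let row : Fin 3 → ℝ → Space := fun i t => WithLp.toLp 2 (F t i)
  have hrowc : ∀ i, ContinuousOn (row i) (Icc 0 η) := fun i =>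
    (PiLp.continuous_toLp 2 _).comp_continuousOn
      (continuousOn_pi.2 fun j t ht => ((hF t ht).2 i j).continuousWithinAt)
  have hproj : ∀ t, t ∈ Icc 0 η → (projIcc 0 η hη.1.le t : ℝ) = t := fun t ht => by
    rw [projIcc_of_mem _ ht]
  let a : ℝ → Space := fun t => σ • row 1 (projIcc 0 η hη.1.le t)
  let p : ℝ → Space := fun t => e₃ + ∫ s in (0 : ℝ)..t, a s
  let g : ℝ → Space := fun t => ∫ s in (0 : ℝ)..t, σ • cross (a s) (p s)
  have ha : Continuous a := by
    refine Continuous.const_smul ?_ σ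
    exact (hrowc 1).comp_continuous (by fun_prop) fun t => (projIcc 0 η hη.1.le t).2
  have hp : ∀ t, HasDerivAt p (a t) t := fun t =>
    (intervalIntegral.integral_hasDerivAt_right (ha.intervalIntegrable _ _)
      ha.stronglyMeasurable.stronglyMeasurableAtFilter ha.continuousAt).const_add e₃
  have hpc : Continuous p := continuous_iff_continuousAt.2 fun t => (hp t).continuousAt
  have hint : Continuous fun t => σ • cross (a t) (p t) := (continuous_cross ha hpc).const_smul σ
  have hrow2 : ∀ t ∈ Icc 0 η, HasDerivWithinAt (row 2) (a t) (Icc 0 η) t := by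
    intro t ht
    have h : HasDerivWithinAt (fun s => F s 2) (fun j => σ * F t 1 j) (Icc 0 η) t := by
      refine hasDerivWithinAt_pi.2 fun j => ((hF t ht).2 2 j).congr_deriv ?_
      simp [Matrix.mul_apply, Fin.sum_univ_three, frenetMatrix]
    have h2 := (PiLp.continuousLinearEquiv 2 ℝ (fun _ : Fin 3 => ℝ)).symm.toContinuousLinearMap
      |>.hasFDerivAt.comp_hasDerivWithinAt t h
    refine h2.congr_deriv ?_
    simp only [a, hproj t ht, row]
    rfl
  have hpN : ∀ t ∈ Icc 0 η, row 2 t = p t := by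
    refine eq_of_has_deriv_right_eq (f' := a)
      (fun t ht => (hrow2 t (Ico_subset_Icc_self ht)).mono_of_mem_nhdsWithin
        (Icc_mem_nhdsGE_of_mem ht)) (fun t _ => (hp t).hasDerivWithinAt)
      (hrowc 2) hpc.continuousOn ?_
    simp only [row, p, hF0, intervalIntegral.integral_same, add_zero]
    ext i
    fin_cases i <;> simp [vertexFrame, e₃]
  have hcross_smul : ∀ x y : Space, cross (σ • x) y = σ • cross x y := by
    intro x y
    simp [cross]
  refine ⟨η, ⟨hη.1, lt_of_le_of_lt hη.2 (half_lt_self hL)⟩, F, a, p, g, ha, fun t => ?_, by simp [p],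
    hp, by simp [g], fun t => ?_, fun t ht => ?_, fun l hl t ht => ?_, hpN, fun t ht => ?_, ?_⟩
  · have h := norm_row_eq_one (hF _ (projIcc 0 η hη.1.le t).2).1 1
    simp only [a, row, norm_smul, h, mul_one]
    rcases hσ with rfl | rfl <;> simp
  · exact intervalIntegral.integral_hasDerivAt_right (hint.intervalIntegrable _ _)
      hint.stronglyMeasurable.stronglyMeasurableAtFilter hint.continuousAt
  · rw [← hpN t ht]
    exact norm_row_eq_one (hF t ht).1 2
  · have h := hF t ⟨ht.1, ht.2.le.trans hl⟩
    exact ⟨h.1, fun a b => (h.2 a b).mono (Ico_subset_Icc_self.trans (Icc_subset_Icc_right hl))⟩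
  · rw [← hpN t ht]
    simp only [a, hproj t ht, hcross_smul, smul_smul, hσ2, one_smul]
    exact (cross_row_one_row_two (hF t ht).1).symm
  · rw [hF0]
    ext i
    fin_cases i <;> simp [vertexFrame, frameTangent]

theorem HasDerivAt.cross {f g : ℝ → Space} {f' g' : Space} {t : ℝ} (hf : HasDerivAt f f' t)
    (hg : HasDerivAt g g' t) :
    HasDerivAt (fun s => _root_.cross (f s) (g s)) (_root_.cross f' (g t) + _root_.cross (f t) g')
      t := by
  have hf' : ∀ i, HasDerivAt (fun s => f s i) (f' i) t := fun i =>
    ((EuclideanSpace.proj i : Space →L[ℝ] ℝ).hasFDerivAt.comp_hasDerivAt t hf)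
  have hg' : ∀ i, HasDerivAt (fun s => g s i) (g' i) t := fun i =>
    ((EuclideanSpace.proj i : Space →L[ℝ] ℝ).hasFDerivAt.comp_hasDerivAt t hg)
  have h : HasDerivAt (fun s => (_root_.cross (f s) (g s)).ofLp)
      (_root_.cross f' (g t) + _root_.cross (f t) g').ofLp t := by
    refine hasDerivAt_pi.2 fun i => ?_
    fin_cases i
    · simp only [PiLp.add_apply, cross_apply_zero, Fin.zero_eta]
      exact (((hf' 1).mul (hg' 2)).sub ((hf' 2).mul (hg' 1))).congr_deriv (by ring)
    · simp only [PiLp.add_apply, cross_apply_one, Fin.mk_one]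
      exact (((hf' 2).mul (hg' 0)).sub ((hf' 0).mul (hg' 2))).congr_deriv (by ring)
    · simp only [PiLp.add_apply, cross_apply_two, Fin.reduceFinMk]
      exact (((hf' 0).mul (hg' 1)).sub ((hf' 1).mul (hg' 0))).congr_deriv (by ring)
  exact (PiLp.continuousLinearEquiv 2 ℝ (fun _ : Fin 3 => ℝ)).symm.toContinuousLinearMap
      |>.hasFDerivAt.comp_hasDerivAt t h

/-! ### Functions with continuous mixed second derivative -/

/-- `fu`, `fv` are the first partial derivatives of `f`, and `fuv` is the mixed second partial
derivative, all of them continuous. -/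
structure HasMixedPartials {E : Type*} [NormedAddCommGroup E] [NormedSpace ℝ E]
    (f fu fv fuv : ℝ × ℝ → E) : Prop where
  continuous_u : Continuous fu
  continuous_v : Continuous fv
  continuous_uv : Continuous fuv
  hasDerivAt_u : ∀ u v, HasDerivAt (fun s => f (s, v)) (fu (u, v)) u
  hasDerivAt_v : ∀ u v, HasDerivAt (fun t => f (u, t)) (fv (u, v)) v
  hasDerivAt_uv : ∀ u v, HasDerivAt (fun t => fu (u, t)) (fuv (u, v)) v
  hasDerivAt_vu : ∀ u v, HasDerivAt (fun s => fv (s, v)) (fuv (u, v)) u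

namespace HasMixedPartials

variable {E : Type*} [NormedAddCommGroup E] [NormedSpace ℝ E] {f fu fv fuv : ℝ × ℝ → E}

theorem hasFDerivAt (h : HasMixedPartials f fu fv fuv) (z : ℝ × ℝ) : HasFDerivAt f
    ((ContinuousLinearMap.toSpanSingleton ℝ (fu z)).coprod
      (ContinuousLinearMap.toSpanSingleton ℝ (fv z))) z := by
  have hc : ∀ k : ℝ × ℝ → E, Continuous k →
      Continuous fun x => ContinuousLinearMap.toSpanSingleton ℝ (k x) := fun k hk =>
    (ContinuousLinearMap.toSpanSingletonCLE (𝕜 := ℝ) (E := E)).continuous.comp hk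
  exact (hasStrictFDerivAt_uncurry_coprod (𝕜 := ℝ) (f := fun u v => f (u, v)) (u := z)
    (f₁ := fun u v => ContinuousLinearMap.toSpanSingleton ℝ (fu (u, v)))
    (f₂ := fun u v => ContinuousLinearMap.toSpanSingleton ℝ (fv (u, v)))
    (.of_forall fun v => (h.hasDerivAt_u v.1 v.2).hasFDerivAt)
    (.of_forall fun v => (h.hasDerivAt_v v.1 v.2).hasFDerivAt)
    (hc fu h.continuous_u).continuousAt (hc fv h.continuous_v).continuousAt).hasFDerivAt

theorem contDiff (h : HasMixedPartials f fu fv fuv) : ContDiff ℝ 1 f := by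
  have hc : ∀ k : ℝ × ℝ → E, Continuous k →
      Continuous fun x => ContinuousLinearMap.toSpanSingleton ℝ (k x) := fun k hk =>
    (ContinuousLinearMap.toSpanSingletonCLE (𝕜 := ℝ) (E := E)).continuous.comp hk
  rw [contDiff_one_iff_hasFDerivAt]
  refine ⟨_, ?_, h.hasFDerivAt⟩
  simp only [← ContinuousLinearMap.comp_fst_add_comp_snd]
  exact ((hc fu h.continuous_u).clm_comp continuous_const).add
    ((hc fv h.continuous_v).clm_comp continuous_const)

theorem continuous (h : HasMixedPartials f fu fv fuv) : Continuous f := h.contDiff.continuous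

end HasMixedPartials

/-- The solution of `f_uv = G` with prescribed values on the axes. -/
theorem hasMixedPartials_integral {E : Type*} [NormedAddCommGroup E] [NormedSpace ℝ E]
    [CompleteSpace E] {p q a b : ℝ → E} {G : ℝ × ℝ → E} (ha : Continuous a) (hb : Continuous b)
    (hG : Continuous G) (hp : ∀ t, HasDerivAt p (a t) t) (hq : ∀ t, HasDerivAt q (b t) t) :
    HasMixedPartials (fun z => p z.1 + q z.2 - p 0 + ∫ s in 0..z.1, ∫ t in 0..z.2, G (s, t))
      (fun z => a z.1 + ∫ t in 0..z.2, G (z.1, t)) (fun z => b z.2 + ∫ s in 0..z.1, G (s, z.2))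
      G := by
  have key : ∀ k : ℝ → E, Continuous k → ∀ t, HasDerivAt (fun x => ∫ s in 0..x, k s) (k t) t :=
    fun k hk t => intervalIntegral.integral_hasDerivAt_right (hk.intervalIntegrable _ _)
      hk.stronglyMeasurable.stronglyMeasurableAtFilter hk.continuousAt
  have c1 : Continuous fun z : ℝ × ℝ => ∫ t in 0..z.2, G (z.1, t) :=
    intervalIntegral.continuous_parametric_intervalIntegral_of_continuous
      (f := fun (z : ℝ × ℝ) t => G (z.1, t)) (by unfold Function.uncurry; fun_prop) continuous_snd
  have c2 : Continuous fun z : ℝ × ℝ => ∫ s in 0..z.1, G (s, z.2) :=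
    intervalIntegral.continuous_parametric_intervalIntegral_of_continuous
      (f := fun (z : ℝ × ℝ) s => G (s, z.2)) (by unfold Function.uncurry; fun_prop) continuous_fst
  refine ⟨by fun_prop, by fun_prop, hG, fun u v => ?_, fun u v => ?_, fun u v => ?_,
    fun u v => ?_⟩
  · have h := key (fun s => ∫ t in 0..v, G (s, t))
      (c1.comp (by fun_prop : Continuous fun s => (s, v))) u
    exact (((hp u).add_const (q v)).sub_const (p 0)).add h
  · have h := key (fun t => ∫ s in 0..u, G (s, t))
      (c2.comp (by fun_prop : Continuous fun t => (u, t))) v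
    -- The variable `v` bounds the inner integral; Fubini moves it to the outer one, where it can be
    -- differentiated.
    have hsw : (fun t => ∫ s in 0..u, ∫ t' in 0..t, G (s, t'))
        = fun t => ∫ t' in 0..t, ∫ s in 0..u, G (s, t') := by
      funext t
      refine MeasureTheory.intervalIntegral_intervalIntegral_swap (F := fun s t => G (s, t)) ?_
      exact (hG.continuousOn.integrableOn_compact (isCompact_uIcc.prod isCompact_uIcc)).mono_set
        (prod_mono uIoc_subset_uIcc uIoc_subset_uIcc)
    have h2 := (((hq v).const_add (p u)).sub_const (p 0)).add h
    rw [← hsw] at h2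
    exact h2
  · exact (key (fun t => G (u, t)) (by fun_prop) v).const_add (a u)
  · exact (key (fun s => G (s, v)) (by fun_prop) u).const_add (b v)

/-- Bounds for the solution of `f_uv = G` and for its first derivatives on a small square. -/
theorem norm_integral_integral_le {E : Type*} [NormedAddCommGroup E] [NormedSpace ℝ E]
    {G : ℝ × ℝ → E} {M δ : ℝ} (hM : ∀ z, ‖G z‖ ≤ M) {u v : ℝ} (hu : u ∈ Icc 0 δ)
    (hv : v ∈ Icc 0 δ) :
    ‖∫ t in 0..v, G (u, t)‖ ≤ M * δ ∧ ‖∫ s in 0..u, G (s, v)‖ ≤ M * δ ∧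
      ‖∫ s in 0..u, ∫ t in 0..v, G (s, t)‖ ≤ M * δ * δ := by
  have hM0 : 0 ≤ M := (norm_nonneg _).trans (hM 0)
  have h1 : ∀ s, ‖∫ t in 0..v, G (s, t)‖ ≤ M * δ := by
    intro s
    refine (intervalIntegral.norm_integral_le_of_norm_le_const fun t _ => hM (s, t)).trans ?_
    rw [sub_zero, abs_of_nonneg hv.1]
    exact mul_le_mul_of_nonneg_left hv.2 hM0
  refine ⟨h1 u, ?_, ?_⟩
  · refine (intervalIntegral.norm_integral_le_of_norm_le_const fun s _ => hM (s, v)).trans ?_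
    rw [sub_zero, abs_of_nonneg hu.1]
    exact mul_le_mul_of_nonneg_left hu.2 hM0
  · refine (intervalIntegral.norm_integral_le_of_norm_le_const fun s _ => h1 s).trans ?_
    rw [sub_zero, abs_of_nonneg hu.1]
    exact mul_le_mul_of_nonneg_left hu.2 (mul_nonneg hM0 (hu.1.trans hu.2))

/-! ### The Goursat problem for the normal -/

theorem norm_inner_smul_le {E : Type*} [NormedAddCommGroup E] [InnerProductSpace ℝ E]
    (x y z : E) : ‖inner ℝ x y • z‖ ≤ ‖x‖ * ‖y‖ * ‖z‖ := by
  rw [norm_smul]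
  exact mul_le_mul_of_nonneg_right (norm_inner_le_norm x y) (norm_nonneg z)

theorem norm_inner_smul_sub_le {E : Type*} [NormedAddCommGroup E] [InnerProductSpace ℝ E]
    (x y z x' y' z' : E) : ‖inner ℝ x y • z - inner ℝ x' y' • z'‖ ≤
      ‖x - x'‖ * ‖y‖ * ‖z‖ + ‖x'‖ * ‖y - y'‖ * ‖z‖ + ‖x'‖ * ‖y'‖ * ‖z - z'‖ := by
  have h : inner ℝ x y • z - inner ℝ x' y' • z'
      = inner ℝ (x - x') y • z + inner ℝ x' (y - y') • z + inner ℝ x' y' • (z - z') := by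
    rw [inner_sub_left, inner_sub_right]
    module
  rw [h]
  exact norm_add₃_le.trans (add_le_add (add_le_add (norm_inner_smul_le _ _ _)
    (norm_inner_smul_le _ _ _)) (norm_inner_smul_le _ _ _))

/-- The Goursat problem for the equation `W_uv = - ⟨W_u, W_v⟩ W`. -/
theorem exists_goursat {E : Type*} [NormedAddCommGroup E] [InnerProductSpace ℝ E]
    [CompleteSpace E] {p q a b : ℝ → E} {δ : ℝ} (hδ : 0 ≤ δ) (hδ1 : δ ≤ 1 / 100)
    (ha : Continuous a) (hb : Continuous b) (ha1 : ∀ t, ‖a t‖ ≤ 1) (hb1 : ∀ t, ‖b t‖ ≤ 1)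
    (hp : ∀ t, HasDerivAt p (a t) t) (hq : ∀ t, HasDerivAt q (b t) t) (hpq : p 0 = q 0)
    (hp1 : ∀ t ∈ Icc 0 δ, ‖p t‖ ≤ 1) (hq1 : ∀ t ∈ Icc 0 δ, ‖q t‖ ≤ 1) :
    ∃ W Wu Wv Wuv : ℝ × ℝ → E, HasMixedPartials W Wu Wv Wuv ∧
      (∀ t, W (t, 0) = p t) ∧ (∀ t, W (0, t) = q t) ∧
      (∀ t, Wu (t, 0) = a t) ∧ (∀ t, Wv (0, t) = b t) ∧
      ∀ u ∈ Icc 0 δ, ∀ v ∈ Icc 0 δ, ‖Wu (u, v)‖ ≤ 3 / 2 ∧ ‖Wv (u, v)‖ ≤ 3 / 2 ∧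
        Wuv (u, v) = -inner ℝ (Wu (u, v)) (Wv (u, v)) • W (u, v) := by
  -- The unknown is `F = W_uv` on the closed square, continued to the plane by projection. Then `W`,
  -- `W_u` and `W_v` are affine in `F` and have the right axis values for every `F`; the equation
  -- becomes the fixed point problem `Φ F = F`.
  let X := C(Icc 0 δ × Icc 0 δ, E)
  let ext : X → ℝ × ℝ → E := fun F z => F (projIcc 0 δ hδ z.1, projIcc 0 δ hδ z.2)
  have hext : ∀ F : X, Continuous (ext F) := fun F => F.continuous.comp (by fun_prop)
  let W : X → ℝ × ℝ → E := fun F z =>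
    p z.1 + q z.2 - p 0 + ∫ s in 0..z.1, ∫ t in 0..z.2, ext F (s, t)
  let Wu : X → ℝ × ℝ → E := fun F z => a z.1 + ∫ t in 0..z.2, ext F (z.1, t)
  let Wv : X → ℝ × ℝ → E := fun F z => b z.2 + ∫ s in 0..z.1, ext F (s, z.2)
  have hW : ∀ F, HasMixedPartials (W F) (Wu F) (Wv F) (ext F) := fun F =>
    hasMixedPartials_integral ha hb (hext F) hp hq
  have hrhs : ∀ F, Continuous fun z : ℝ × ℝ => -inner ℝ (Wu F z) (Wv F z) • W F z := fun F => by
    have h1 := (hW F).continuous_u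
    have h2 := (hW F).continuous_v
    have h3 := (hW F).continuous
    fun_prop
  let Φ : X → X := fun F =>
    ⟨fun z => -inner ℝ (Wu F (z.1, z.2)) (Wv F (z.1, z.2)) • W F (z.1, z.2),
      (hrhs F).comp (by fun_prop : Continuous fun z : Icc 0 δ × Icc 0 δ => ((z.1 : ℝ), (z.2 : ℝ)))⟩
  have hextn : ∀ F : X, ‖F‖ ≤ 8 → ∀ z, ‖ext F z‖ ≤ 8 := fun F hF z =>
    (F.norm_coe_le_norm _).trans hF
  have hext_sub : ∀ F F' : X, ∀ z, ext (F - F') z = ext F z - ext F' z := fun F F' z => rfl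
  have hΦ : ∀ F : X, ∀ z : Icc 0 δ × Icc 0 δ,
      Φ F z = -inner ℝ (Wu F (z.1, z.2)) (Wv F (z.1, z.2)) • W F (z.1, z.2) := fun F z => rfl
  have hextu : ∀ F : X, ∀ v, Continuous fun s => ext F (s, v) := fun F v =>
    (hext F).comp (by fun_prop : Continuous fun s : ℝ => (s, v))
  have hextv : ∀ F : X, ∀ u, Continuous fun t => ext F (u, t) := fun F u =>
    (hext F).comp (by fun_prop : Continuous fun t : ℝ => (u, t))
  have isub : ∀ k k' : ℝ → E, Continuous k → Continuous k' → ∀ {x : ℝ},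
      ∫ s in 0..x, (k s - k' s) = (∫ s in 0..x, k s) - ∫ s in 0..x, k' s := fun k k' hk hk' x =>
    intervalIntegral.integral_sub (hk.intervalIntegrable _ _) (hk'.intervalIntegrable _ _)
  -- The radius `8` is preserved: `1 + 8/100 ≤ 3/2` and `3 + 8/100² ≤ 7/2`, while `(3/2)(3/2)(7/2) <
  -- 8`.
  have hbound : ∀ F : X, ‖F‖ ≤ 8 → ∀ u ∈ Icc 0 δ, ∀ v ∈ Icc 0 δ,
      ‖Wu F (u, v)‖ ≤ 3 / 2 ∧ ‖Wv F (u, v)‖ ≤ 3 / 2 ∧ ‖W F (u, v)‖ ≤ 7 / 2 := by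
    intro F hF u hu v hv
    obtain ⟨h1, h2, h3⟩ := norm_integral_integral_le (hextn F hF) hu hv
    have h0 : ‖p u + q v - p 0‖ ≤ 3 := by
      refine (norm_sub_le _ _).trans ?_
      have := norm_add_le (p u) (q v)
      linarith [hp1 u hu, hq1 v hv, hp1 0 (left_mem_Icc.2 hδ)]
    refine ⟨(norm_add_le _ _).trans ?_, (norm_add_le _ _).trans ?_, (norm_add_le _ _).trans ?_⟩
    · dsimp only; linarith [ha1 u]
    · dsimp only; linarith [hb1 v]
    · dsimp only; nlinarith
  have hlip : ∀ F : X, ‖F‖ ≤ 8 → ∀ F' : X, ‖F'‖ ≤ 8 → dist (Φ F) (Φ F') ≤ 1 / 2 * dist F F' := by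
    intro F hF F' hF'
    refine (ContinuousMap.dist_le (by positivity)).2 fun z => ?_
    obtain ⟨⟨u, hu⟩, ⟨v, hv⟩⟩ := z
    obtain ⟨h1, h2, h3⟩ := norm_integral_integral_le
      (G := ext (F - F')) (M := dist F F') (fun z => by
        rw [dist_eq_norm]; exact ContinuousMap.norm_coe_le_norm (F - F') _) hu hv
    have e1 : Wu F (u, v) - Wu F' (u, v) = ∫ t in 0..v, ext (F - F') (u, t) := by
      simp only [Wu, hext_sub]
      rw [isub _ _ (hextv F u) (hextv F' u)]
      abel
    have e2 : Wv F (u, v) - Wv F' (u, v) = ∫ s in 0..u, ext (F - F') (s, v) := by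
      simp only [Wv, hext_sub]
      rw [isub _ _ (hextu F v) (hextu F' v)]
      abel
    have e3 : W F (u, v) - W F' (u, v) = ∫ s in 0..u, ∫ t in 0..v, ext (F - F') (s, t) := by
      have hc : ∀ F : X, Continuous fun s => ∫ t in 0..v, ext F (s, t) := fun F =>
        intervalIntegral.continuous_parametric_intervalIntegral_of_continuous'
          (f := fun s t => ext F (s, t)) (hext F) 0 v
      have : ∀ s, ∫ t in 0..v, ext (F - F') (s, t)
          = (∫ t in 0..v, ext F (s, t)) - ∫ t in 0..v, ext F' (s, t) := by
        intro s
        simp only [hext_sub]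
        rw [isub _ _ (hextv F s) (hextv F' s)]
      simp only [W, this]
      rw [isub _ _ (hc F) (hc F')]
      abel
    rw [← e1] at h1
    rw [← e2] at h2
    rw [← e3] at h3
    obtain ⟨b1, b2, b3⟩ := hbound F hF u hu v hv
    obtain ⟨b1', b2', b3'⟩ := hbound F' hF' u hu v hv
    have h := norm_inner_smul_sub_le (Wu F (u, v)) (Wv F (u, v)) (W F (u, v))
      (Wu F' (u, v)) (Wv F' (u, v)) (W F' (u, v))
    have hd : dist (Φ F (⟨u, hu⟩, ⟨v, hv⟩)) (Φ F' (⟨u, hu⟩, ⟨v, hv⟩))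
        = ‖inner ℝ (Wu F (u, v)) (Wv F (u, v)) • W F (u, v) -
          inner ℝ (Wu F' (u, v)) (Wv F' (u, v)) • W F' (u, v)‖ := by
      rw [dist_eq_norm, ← norm_neg, hΦ, hΦ]
      congr 1
      module
    rw [hd]
    refine h.trans ?_
    set D := dist F F' with hD
    have hD0 : 0 ≤ D := dist_nonneg
    -- Each factor of the cubic right-hand side is varied in turn. Every variation carries a factor
    -- `δ ≤ 1/100`, so the sum stays below `D / 2`.
    have t1 : ‖Wu F (u, v) - Wu F' (u, v)‖ * ‖Wv F (u, v)‖ * ‖W F (u, v)‖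
        ≤ (D * (1 / 100)) * (3 / 2) * (7 / 2) := by
      gcongr
      exact h1.trans (by gcongr)
    have t2 : ‖Wu F' (u, v)‖ * ‖Wv F (u, v) - Wv F' (u, v)‖ * ‖W F (u, v)‖
        ≤ (3 / 2) * (D * (1 / 100)) * (7 / 2) := by
      gcongr
      exact h2.trans (by gcongr)
    have t3 : ‖Wu F' (u, v)‖ * ‖Wv F' (u, v)‖ * ‖W F (u, v) - W F' (u, v)‖
        ≤ (3 / 2) * (3 / 2) * (D * (1 / 100) * (1 / 100)) := by
      gcongr
      exact h3.trans (by gcongr)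
    linarith
  have hmaps : MapsTo Φ (closedBall 0 8) (closedBall 0 8) := by
    intro F hF
    rw [mem_closedBall_zero_iff] at hF ⊢
    refine (ContinuousMap.norm_le _ (by norm_num)).2 fun z => ?_
    obtain ⟨b1, b2, b3⟩ := hbound F hF z.1 z.1.2 z.2 z.2.2
    have h := norm_inner_smul_le (Wu F (z.1, z.2)) (Wv F (z.1, z.2)) (W F (z.1, z.2))
    have t1 : ‖Wu F (z.1, z.2)‖ * ‖Wv F (z.1, z.2)‖ * ‖W F (z.1, z.2)‖
        ≤ 3 / 2 * (3 / 2) * (7 / 2) := by gcongr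
    have : ‖Φ F z‖ = ‖inner ℝ (Wu F (z.1, z.2)) (Wv F (z.1, z.2)) • W F (z.1, z.2)‖ := by
      rw [hΦ, neg_smul, norm_neg]
    rw [this]
    linarith
  have hcontr : ContractingWith (1 / 2) (hmaps.restrict Φ _ _) := by
    refine ⟨NNReal.half_lt_self one_ne_zero, LipschitzWith.of_dist_le_mul fun F F' => ?_⟩
    have := hlip F (mem_closedBall_zero_iff.1 F.2) F' (mem_closedBall_zero_iff.1 F'.2)
    rw [NNReal.coe_div, NNReal.coe_one, NNReal.coe_ofNat]
    exact this
  obtain ⟨F, hF, hfix, -⟩ := hcontr.exists_fixedPoint' isClosed_closedBall.isComplete hmaps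
    (mem_closedBall_self (by norm_num : (0 : ℝ) ≤ 8)) (edist_ne_top _ _)
  rw [mem_closedBall_zero_iff] at hF
  refine ⟨W F, Wu F, Wv F, ext F, hW F, fun t => ?_, fun t => ?_, fun t => ?_, fun t => ?_,
    fun u hu v hv => ⟨(hbound F hF u hu v hv).1, (hbound F hF u hu v hv).2.1, ?_⟩⟩
  · simp [W, hpq]
  · simp [W]
  · simp [Wu]
  · simp [Wv]
  · have h : ext F (u, v) = F (⟨u, hu⟩, ⟨v, hv⟩) := by
      simp only [ext, projIcc_of_mem hδ hu, projIcc_of_mem hδ hv]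
    rw [h]
    exact (DFunLike.congr_fun hfix.eq.symm (⟨u, hu⟩, ⟨v, hv⟩)).trans (hΦ F _)

/-- A solution of `W_uv = - ⟨W_u, W_v⟩ W` with values in the unit sphere on the axes takes its values
in the unit sphere. -/
theorem norm_eq_one_of_goursat {E : Type*} [NormedAddCommGroup E] [InnerProductSpace ℝ E]
    {W Wu Wv Wuv : ℝ × ℝ → E} (h : HasMixedPartials W Wu Wv Wuv) {δ : ℝ} (hδ : 0 < δ)
    (hδ1 : δ ≤ 1 / 100) (h0u : ∀ t ∈ Icc 0 δ, ‖W (t, 0)‖ = 1) (h0v : ∀ t ∈ Icc 0 δ, ‖W (0, t)‖ = 1)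
    (hW : ∀ u ∈ Icc 0 δ, ∀ v ∈ Icc 0 δ, ‖Wu (u, v)‖ ≤ 3 / 2 ∧ ‖Wv (u, v)‖ ≤ 3 / 2 ∧
      Wuv (u, v) = -inner ℝ (Wu (u, v)) (Wv (u, v)) • W (u, v)) :
    ∀ u ∈ Icc 0 δ, ∀ v ∈ Icc 0 δ, ‖W (u, v)‖ = 1 := by
  -- The defect satisfies `z_uv = -2 ⟨W_u, W_v⟩ z` and vanishes on both axes. If `Z` is the maximum
  -- of `|z|`, integrating twice gives `Z ≤ 2 (3/2)² δ² Z`, which forces `Z = 0` for `δ ≤ 1/100`.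
  let z : ℝ × ℝ → ℝ := fun x => inner ℝ (W x) (W x) - 1
  have hz0 : ∀ x, ‖W x‖ = 1 → z x = 0 := fun x hx => by
    simp only [z, real_inner_self_eq_norm_sq, hx]; norm_num
  have hWc := h.continuous
  have hzc : Continuous z := by fun_prop
  have hzu : ∀ u v, HasDerivAt (fun s => z (s, v)) (2 * inner ℝ (W (u, v)) (Wu (u, v))) u :=
    fun u v => (((h.hasDerivAt_u u v).inner ℝ (h.hasDerivAt_u u v)).sub_const 1).congr_deriv (by
      rw [real_inner_comm (Wu (u, v))]; ring)
  have hk : ∀ u ∈ Icc 0 δ, inner ℝ (W (u, 0)) (Wu (u, 0)) = (0 : ℝ) := by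
    intro u hu
    have h1 := (hzu u 0).hasDerivWithinAt (s := Icc 0 δ)
    have h2 : HasDerivWithinAt (fun s => z (s, 0)) 0 (Icc 0 δ) u :=
      (hasDerivWithinAt_const u (Icc 0 δ) (0 : ℝ)).congr (fun t ht => hz0 _ (h0u t ht))
        (hz0 _ (h0u u hu))
    have h3 := (uniqueDiffOn_Icc hδ u hu).eq_deriv _ h1 h2
    linarith
  obtain ⟨x₀, hx₀, hmax⟩ := (isCompact_Icc.prod isCompact_Icc).exists_isMaxOn
    (⟨(0, 0), ⟨left_mem_Icc.2 hδ.le, left_mem_Icc.2 hδ.le⟩⟩ : (Icc 0 δ ×ˢ Icc 0 δ).Nonempty)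
    hzc.norm.continuousOn
  set Z := ‖z x₀‖ with hZ
  have hZ0 : 0 ≤ Z := norm_nonneg _
  have hbd : ∀ u ∈ Icc 0 δ, ∀ v ∈ Icc 0 δ, ‖z (u, v)‖ ≤ Z := fun u hu v hv => hmax ⟨hu, hv⟩
  have hder : ∀ u ∈ Icc 0 δ, ∀ v ∈ Icc 0 δ,
      ‖(inner ℝ (W (u, v)) (Wu (u, v)) : ℝ)‖ ≤ 9 / 4 * Z * δ := by
    intro u hu v hv
    have h1 := norm_image_sub_le_of_norm_deriv_le_segment' (a := 0) (b := δ)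
      (f := fun t => (inner ℝ (W (u, t)) (Wu (u, t)) : ℝ)) (C := 9 / 4 * Z)
      (fun t _ => ((h.hasDerivAt_v u t).inner ℝ (h.hasDerivAt_uv u t)).hasDerivWithinAt)
      (fun t ht => ?_) v hv
    · rw [hk u hu, sub_zero, sub_zero] at h1
      exact h1.trans (mul_le_mul_of_nonneg_left hv.2 (by positivity))
    · have ht' := Ico_subset_Icc_self ht
      obtain ⟨b1, b2, b3⟩ := hW u hu t ht'
      have e : (inner ℝ (W (u, t)) (Wuv (u, t)) + inner ℝ (Wv (u, t)) (Wu (u, t)) : ℝ)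
          = -(inner ℝ (Wu (u, t)) (Wv (u, t)) * z (u, t)) := by
        rw [b3, inner_smul_right, real_inner_comm (Wu (u, t))]
        simp only [z]
        ring
      rw [e, norm_neg, norm_mul]
      have h2 := (norm_inner_le_norm (𝕜 := ℝ) (Wu (u, t)) (Wv (u, t)))
      calc _ ≤ (3 / 2 * (3 / 2)) * Z := by
            gcongr
            · exact h2.trans (by gcongr)
            · exact hbd u hu t ht'
        _ = _ := by ring
  have hle : Z ≤ 9 / 2 * Z * δ * δ := by
    have h1 := norm_image_sub_le_of_norm_deriv_le_segment' (a := 0) (b := δ)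
      (f := fun s => z (s, x₀.2)) (C := 9 / 2 * Z * δ)
      (fun s _ => (hzu s x₀.2).hasDerivWithinAt) (fun s hs => ?_) x₀.1 hx₀.1
    · rw [hz0 _ (h0v x₀.2 hx₀.2), sub_zero, sub_zero] at h1
      exact h1.trans (mul_le_mul_of_nonneg_left hx₀.1.2 (by positivity))
    · rw [norm_mul, Real.norm_ofNat]
      linarith [hder s (Ico_subset_Icc_self hs) x₀.2 hx₀.2]
  have hZz : Z = 0 := by
    have : δ * δ ≤ 1 / 100 * (1 / 100) := by gcongr
    nlinarith
  intro u hu v hv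
  have h1 : z (u, v) = 0 := norm_le_zero_iff.1 (hZz ▸ hbd u hu v hv)
  simp only [z, real_inner_self_eq_norm_sq] at h1
  nlinarith [norm_nonneg (W (u, v))]

/-! ### Fronts from their normals -/

theorem cross_smul_left_self (c : ℝ) (x : Space) : cross (c • x) x = 0 := by
  simp [cross]

theorem space_cross_anticomm (x y : Space) : cross x y = -cross y x := by
  ext i
  fin_cases i <;> simp [cross_apply_zero, cross_apply_one, cross_apply_two] <;> ring

/-- A pseudospherical front on a square, continued to the plane: `r` and `N` are `C^{1M}` on the
plane, and they form a pseudospherical front on `[0, ρ]²` as soon as they are regular there. -/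
structure IsFrontOn (ρ : ℝ) (N Nu Nv Nuv r ru rv ruv : ℝ × ℝ → Space) : Prop where
  normal : HasMixedPartials N Nu Nv Nuv
  front : HasMixedPartials r ru rv ruv
  norm_normal : ∀ u ∈ Icc 0 ρ, ∀ v ∈ Icc 0 ρ, ‖N (u, v)‖ = 1
  moutard : ∀ u ∈ Icc 0 ρ, ∀ v ∈ Icc 0 ρ,
    Nuv (u, v) = -inner ℝ (Nu (u, v)) (Nv (u, v)) • N (u, v)
  lelieuvre_u : ∀ u ∈ Icc 0 ρ, ∀ v ∈ Icc 0 ρ, ru (u, v) = cross (Nu (u, v)) (N (u, v))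
  lelieuvre_v : ∀ u ∈ Icc 0 ρ, ∀ v ∈ Icc 0 ρ, rv (u, v) = -cross (Nv (u, v)) (N (u, v))

/-- There is a pseudospherical front with prescribed asymptotic curves through a point. -/
theorem exists_isFrontOn {κ κ' : ℝ → ℝ} {β β' η η' : ℝ} {F F' : ℝ → Matrix (Fin 3) (Fin 3) ℝ}
    {a p g b q h : ℝ → Space} (hη : 0 < η) (hη' : 0 < η') (hu : IsAsymptoticCurve κ 1 β η F a p g)
    (hv : IsAsymptoticCurve κ' (-1) β' η' F' b q h) :
    ∃ ρ > 0, ∃ N Nu Nv Nuv r ru rv ruv, IsFrontOn ρ N Nu Nv Nuv r ru rv ruv ∧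
      (∀ t, N (t, 0) = p t) ∧ (∀ t, N (0, t) = q t) ∧
      (∀ t, r (t, 0) = g t) ∧ (∀ t, r (0, t) = h t) ∧
      ru 0 = !₂[Real.cos β, Real.sin β, 0] ∧ rv 0 = !₂[Real.cos β', Real.sin β', 0] := by
  set ρ : ℝ := min (1 / 100) (min η η') with hρ
  have hρ0 : 0 < ρ := lt_min (by norm_num) (lt_min hη hη')
  have hρη : Icc 0 ρ ⊆ Icc 0 η :=
    Icc_subset_Icc_right ((min_le_right _ _).trans (min_le_left _ _))
  have hρη' : Icc 0 ρ ⊆ Icc 0 η' :=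
    Icc_subset_Icc_right ((min_le_right _ _).trans (min_le_right _ _))
  have h0 : (0 : ℝ) ∈ Icc 0 ρ := left_mem_Icc.2 hρ0.le
  obtain ⟨N, Nu, Nv, Nuv, hN, hN1, hN2, hNu, hNv, hNsq⟩ := exists_goursat hρ0.le (min_le_left _ _)
    hu.continuous hv.continuous hu.norm_le hv.norm_le hu.hasDerivAt_normal hv.hasDerivAt_normal
    (hu.normal_zero.trans hv.normal_zero.symm) (fun t ht => (hu.norm_normal t (hρη ht)).le)
    (fun t ht => (hv.norm_normal t (hρη' ht)).le)
  have hunit := norm_eq_one_of_goursat hN hρ0 (min_le_left _ _)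
    (fun t ht => by rw [hN1]; exact hu.norm_normal t (hρη ht))
    (fun t ht => by rw [hN2]; exact hv.norm_normal t (hρη' ht)) hNsq
  have hpc : Continuous p :=
    continuous_iff_continuousAt.2 fun t => (hu.hasDerivAt_normal t).continuousAt
  have hqc : Continuous q :=
    continuous_iff_continuousAt.2 fun t => (hv.hasDerivAt_normal t).continuousAt
  -- The position is the solution of `r_uv = N_u × N_v` with the given axis curves. Since `N_uv × N
  -- = 0`, this is the derivative of `N_u × N` in `v` and of `-N_v × N` in `u`, so the Lelieuvre
  -- equations spread from the axes to the square.
  have hG : Continuous fun x => cross (Nu x) (Nv x) :=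
    continuous_cross hN.continuous_u hN.continuous_v
  have hr := hasMixedPartials_integral ((continuous_cross hu.continuous hpc).const_smul (1 : ℝ))
    ((continuous_cross hv.continuous hqc).const_smul (-1 : ℝ)) hG hu.hasDerivAt_curve
    hv.hasDerivAt_curve
  have hsub : ∀ x ∈ Icc 0 ρ, uIcc 0 x ⊆ Icc 0 ρ := fun x hx => by
    rw [uIcc_of_le hx.1]; exact Icc_subset_Icc_right hx.2
  have hlu : ∀ u ∈ Icc 0 ρ, ∀ v ∈ Icc 0 ρ,
      (1 : ℝ) • cross (a u) (p u) + ∫ t in 0..v, cross (Nu (u, t)) (Nv (u, t))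
        = cross (Nu (u, v)) (N (u, v)) := by
    intro u hu v hv
    have h1 := intervalIntegral.integral_eq_sub_of_hasDerivAt
      (f := fun t => cross (Nu (u, t)) (N (u, t))) (f' := fun t => cross (Nu (u, t)) (Nv (u, t)))
      (a := 0) (b := v) (fun t ht => ?_)
      ((hG.comp (by fun_prop : Continuous fun t : ℝ => (u, t))).intervalIntegrable _ _)
    · rw [h1, hNu, hN1]
      module
    · have h2 := (hN.hasDerivAt_uv u t).cross (hN.hasDerivAt_v u t)
      rwa [(hNsq u hu t (hsub v hv ht)).2.2, cross_smul_left_self, zero_add] at h2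
  have hlv : ∀ u ∈ Icc 0 ρ, ∀ v ∈ Icc 0 ρ,
      (-1 : ℝ) • cross (b v) (q v) + ∫ s in 0..u, cross (Nu (s, v)) (Nv (s, v))
        = -cross (Nv (u, v)) (N (u, v)) := by
    intro u hu v hv
    have h1 := intervalIntegral.integral_eq_sub_of_hasDerivAt
      (f := fun s => -cross (Nv (s, v)) (N (s, v))) (f' := fun s => cross (Nu (s, v)) (Nv (s, v)))
      (a := 0) (b := u) (fun s hs => ?_)
      ((hG.comp (by fun_prop : Continuous fun s : ℝ => (s, v))).intervalIntegrable _ _)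
    · rw [h1, hNv, hN2]
      module
    · have h2 := ((hN.hasDerivAt_vu s v).cross (hN.hasDerivAt_u s v)).neg
      rw [(hNsq s (hsub u hu hs) v hv).2.2, cross_smul_left_self, zero_add,
        ← space_cross_anticomm] at h2
      exact h2
  refine ⟨ρ, hρ0, N, Nu, Nv, Nuv, _, _, _, _, ⟨hN, hr, hunit, fun u hu v hv => (hNsq u hu v hv).2.2,
    hlu, hlv⟩, hN1, hN2, fun t => ?_, fun t => ?_, ?_, ?_⟩
  · simp [hu.curve_zero, hv.curve_zero]
  · simp
  · rw [← hu.frameTangent_zero, hu.frameTangent_eq 0 (hρη h0)]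
    simp
  · rw [← hv.frameTangent_zero, hv.frameTangent_eq 0 (hρη' h0)]
    simp

/-! ### Restriction to half-open rectangles -/

section Rectangle

variable {E : Type*} [NormedAddCommGroup E] [NormedSpace ℝ E] {A B : ℝ} {f g gu gv guv : ℝ × ℝ → E}
  {y : E} {p : ℝ × ℝ}

theorem hasDerivWithinAt_rectangle_u (hfg : EqOn f g (Ico 0 A ×ˢ Ico 0 B))
    (hp : p ∈ Ico 0 A ×ˢ Ico 0 B) (hd : HasDerivAt (fun s => g (s, p.2)) y p.1) :
    HasDerivWithinAt (fun s => f (s, p.2)) y {s | (s, p.2) ∈ Ico 0 A ×ˢ Ico 0 B} p.1 :=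
  hd.hasDerivWithinAt.congr (fun _ hs => hfg hs) (hfg hp)

theorem hasDerivWithinAt_rectangle_v (hfg : EqOn f g (Ico 0 A ×ˢ Ico 0 B))
    (hp : p ∈ Ico 0 A ×ˢ Ico 0 B) (hd : HasDerivAt (fun t => g (p.1, t)) y p.2) :
    HasDerivWithinAt (fun t => f (p.1, t)) y {t | (p.1, t) ∈ Ico 0 A ×ˢ Ico 0 B} p.2 :=
  hd.hasDerivWithinAt.congr (fun _ hs => hfg hs) (hfg hp)

/-- The slice through `p` is a half-open interval, where one-sided derivatives are unique even at
`0`; so the partial derivative within the rectangle is that of the continuation `g`. -/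
theorem partialU_rectangle (hfg : EqOn f g (Ico 0 A ×ˢ Ico 0 B))
    (hp : p ∈ Ico 0 A ×ˢ Ico 0 B) (hd : HasDerivAt (fun s => g (s, p.2)) y p.1) :
    partialU (Ico 0 A ×ˢ Ico 0 B) f p = y := by
  refine (hasDerivWithinAt_rectangle_u hfg hp hd).derivWithin ?_
  have h : {s | (s, p.2) ∈ Ico 0 A ×ˢ Ico 0 B} = Ico 0 A := by
    ext s
    exact ⟨fun h => h.1, fun h => ⟨h, hp.2⟩⟩
  rw [h]
  exact uniqueDiffOn_Ico 0 A p.1 hp.1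

theorem partialV_rectangle (hfg : EqOn f g (Ico 0 A ×ˢ Ico 0 B))
    (hp : p ∈ Ico 0 A ×ˢ Ico 0 B) (hd : HasDerivAt (fun t => g (p.1, t)) y p.2) :
    partialV (Ico 0 A ×ˢ Ico 0 B) f p = y := by
  refine (hasDerivWithinAt_rectangle_v hfg hp hd).derivWithin ?_
  have h : {t | (p.1, t) ∈ Ico 0 A ×ˢ Ico 0 B} = Ico 0 B := by
    ext s
    exact ⟨fun h => h.2, fun h => ⟨hp.1, h⟩⟩
  rw [h]
  exact uniqueDiffOn_Ico 0 B p.2 hp.2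

namespace HasMixedPartials

theorem eqOn_partialU (h : HasMixedPartials g gu gv guv)
    (hfg : EqOn f g (Ico 0 A ×ˢ Ico 0 B)) :
    EqOn (partialU (Ico 0 A ×ˢ Ico 0 B) f) gu (Ico 0 A ×ˢ Ico 0 B) :=
  fun p hp => partialU_rectangle hfg hp (h.hasDerivAt_u p.1 p.2)

theorem eqOn_partialV (h : HasMixedPartials g gu gv guv)
    (hfg : EqOn f g (Ico 0 A ×ˢ Ico 0 B)) :
    EqOn (partialV (Ico 0 A ×ˢ Ico 0 B) f) gv (Ico 0 A ×ˢ Ico 0 B) :=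
  fun p hp => partialV_rectangle hfg hp (h.hasDerivAt_v p.1 p.2)

theorem eqOn_partialV_partialU (h : HasMixedPartials g gu gv guv)
    (hfg : EqOn f g (Ico 0 A ×ˢ Ico 0 B)) :
    EqOn (partialV (Ico 0 A ×ˢ Ico 0 B) (partialU (Ico 0 A ×ˢ Ico 0 B) f)) guv
      (Ico 0 A ×ˢ Ico 0 B) :=
  fun p hp => partialV_rectangle (h.eqOn_partialU hfg) hp (h.hasDerivAt_uv p.1 p.2)

theorem isC1M (h : HasMixedPartials g gu gv guv)
    (hfg : EqOn f g (Ico 0 A ×ˢ Ico 0 B)) : IsC1M (Ico 0 A ×ˢ Ico 0 B) f where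
  hasPartials p hp :=
    ⟨(hasDerivWithinAt_rectangle_u hfg hp (h.hasDerivAt_u p.1 p.2)).differentiableWithinAt,
      (hasDerivWithinAt_rectangle_v hfg hp (h.hasDerivAt_v p.1 p.2)).differentiableWithinAt⟩
  continuousOn := h.continuous.continuousOn.congr hfg
  continuousOn_u := h.continuous_u.continuousOn.congr (h.eqOn_partialU hfg)
  continuousOn_v := h.continuous_v.continuousOn.congr (h.eqOn_partialV hfg)
  differentiable_uv p hp := (hasDerivWithinAt_rectangle_v (h.eqOn_partialU hfg) hp
    (h.hasDerivAt_uv p.1 p.2)).differentiableWithinAt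
  differentiable_vu p hp := (hasDerivWithinAt_rectangle_u (h.eqOn_partialV hfg) hp
    (h.hasDerivAt_vu p.1 p.2)).differentiableWithinAt
  mixed_eq p hp := (h.eqOn_partialV_partialU hfg hp).trans
    (partialU_rectangle (h.eqOn_partialV hfg) hp (h.hasDerivAt_vu p.1 p.2)).symm
  continuousOn_uv := h.continuous_uv.continuousOn.congr (h.eqOn_partialV_partialU hfg)

end HasMixedPartials

end Rectangle

theorem cross_zero_left (x : Space) : cross 0 x = 0 := by simp [cross]

/-- A front on a square restricts to a pseudospherical front on every half-open rectangle on which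
it is weakly regular. -/
theorem IsFrontOn.isPSFront {ρ A B : ℝ} {N Nu Nv Nuv r ru rv ruv f k : ℝ × ℝ → Space}
    (h : IsFrontOn ρ N Nu Nv Nuv r ru rv ruv) (hA : A ≤ ρ) (hB : B ≤ ρ)
    (hf : EqOn f r (Ico 0 A ×ˢ Ico 0 B)) (hk : EqOn k N (Ico 0 A ×ˢ Ico 0 B))
    (hru : ∀ x ∈ Ico 0 A ×ˢ Ico 0 B, ru x ≠ 0) (hrv : ∀ x ∈ Ico 0 A ×ˢ Ico 0 B, rv x ≠ 0) :
    IsPSFront (Ico 0 A ×ˢ Ico 0 B) f k := by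
  have hmem : ∀ x ∈ Ico 0 A ×ˢ Ico 0 B, x.1 ∈ Icc 0 ρ ∧ x.2 ∈ Icc 0 ρ := fun x hx =>
    ⟨⟨hx.1.1, hx.1.2.le.trans hA⟩, ⟨hx.2.1, hx.2.2.le.trans hB⟩⟩
  have hlu : ∀ x ∈ Ico 0 A ×ˢ Ico 0 B, ru x = cross (Nu x) (N x) := fun x hx =>
    h.lelieuvre_u x.1 (hmem x hx).1 x.2 (hmem x hx).2
  have hlv : ∀ x ∈ Ico 0 A ×ˢ Ico 0 B, rv x = -cross (Nv x) (N x) := fun x hx =>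
    h.lelieuvre_v x.1 (hmem x hx).1 x.2 (hmem x hx).2
  have hNu := h.normal.eqOn_partialU hk
  have hNv := h.normal.eqOn_partialV hk
  have hfu := h.front.eqOn_partialU hf
  have hfv := h.front.eqOn_partialV hf
  refine ⟨⟨fun x hx => ?_, h.normal.isC1M hk, fun x hx h0 => ?_, fun x hx h0 => ?_,
    fun x => -inner ℝ (Nu x) (Nv x), ?_, fun x hx => ?_⟩, h.front.isC1M hf, fun x hx => ?_,
    fun x hx => ?_, fun x hx => ?_, fun x hx => ?_⟩
  · rw [hk hx]
    exact h.norm_normal x.1 (hmem x hx).1 x.2 (hmem x hx).2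
  -- By the Lelieuvre equations a zero of `N_u` or `N_v` would be one of `r_u` or `r_v`.
  · rw [hNu hx] at h0
    exact hru x hx (by rw [hlu x hx, h0, cross_zero_left])
  · rw [hNv hx] at h0
    exact hrv x hx (by rw [hlv x hx, h0, cross_zero_left, neg_zero])
  · have h1 := h.normal.continuous_u
    have h2 := h.normal.continuous_v
    fun_prop
  · rw [h.normal.eqOn_partialV_partialU hk hx, hk hx]
    exact h.moutard x.1 (hmem x hx).1 x.2 (hmem x hx).2
  · rw [hfu hx]; exact hru x hx
  · rw [hfv hx]; exact hrv x hx
  · rw [hfu hx, hNu hx, hk hx]; exact hlu x hx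
  · rw [hfv hx, hNv hx, hk hx]; exact hlv x hx

/-! ### Stars, sectors and cones -/

/-- The index of the bounding ray of the sector `S_i` along which `u` is measured. -/
def evenRay (i : ℕ) : ℕ := if Even i then i else i - 1

/-- The index of the bounding ray of the sector `S_i` along which `v` is measured. -/
def oddRay (i : ℕ) : ℕ := if Even i then i - 1 else i

/-- The ray with index `0` is identified with the ray with index `2m`. -/
def rayIndex (m k : ℕ) : ℕ := if k = 0 then 2 * m else k

/-- The oriented area spanned by two vectors of the plane. -/
def area (x y : Plane) : ℝ := x 0 * y 1 - x 1 * y 0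

/-- The unit vector with direction angle `θ`. -/
def unitVec (θ : ℝ) : Plane := !₂[Real.cos θ, Real.sin θ]

theorem rayDir_eq (α : ℕ → ℝ) (i : ℕ) : rayDir α i = unitVec (rayAngle α i) := rfl

theorem area_unitVec (θ φ : ℝ) : area (unitVec θ) (unitVec φ) = Real.sin (φ - θ) := by
  simp only [area, unitVec, PiLp.toLp_apply, Matrix.cons_val_zero, Matrix.cons_val_one]
  rw [Real.sin_sub]; ring

theorem norm_unitVec (θ : ℝ) : ‖unitVec θ‖ = 1 := by
  have h : ‖unitVec θ‖ ^ 2 = 1 := by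
    rw [plane_norm_sq, ← Real.cos_sq_add_sin_sq θ]; rfl
  nlinarith [norm_nonneg (unitVec θ)]

theorem sectorPoint_eq (α : ℕ → ℝ) (i : ℕ) (z : ℝ × ℝ) :
    sectorPoint α i z = z.1 • rayDir α (evenRay i) + z.2 • rayDir α (oddRay i) := by
  unfold sectorPoint evenRay oddRay
  split_ifs <;> rfl

theorem sectorRect_eq (m : ℕ) (l : ℕ → ℝ) (i : ℕ) :
    sectorRect m l i = Ico 0 (rayLength m l (evenRay i)) ×ˢ Ico 0 (rayLength m l (oddRay i)) := by
  unfold sectorRect evenRay oddRay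
  split_ifs <;> rfl

theorem rayLength_eq (m : ℕ) (l : ℕ → ℝ) (k : ℕ) : rayLength m l k = l (rayIndex m k) := by
  unfold rayLength rayIndex
  split_ifs <;> rfl

theorem sector_eq (m : ℕ) (α l : ℕ → ℝ) (i : ℕ) :
    sector m α l i = sectorPoint α i '' sectorRect m l i := by
  ext x
  unfold sector sectorRect sectorPoint
  split_ifs
  · constructor
    · rintro ⟨c, hc, d, hd, rfl⟩
      exact ⟨(d, c), ⟨hd, hc⟩, add_comm _ _⟩
    · rintro ⟨⟨d, c⟩, ⟨hd, hc⟩, rfl⟩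
      exact ⟨c, hc, d, hd, add_comm _ _⟩
  · constructor
    · rintro ⟨c, hc, d, hd, rfl⟩
      exact ⟨(c, d), ⟨hc, hd⟩, rfl⟩
    · rintro ⟨⟨c, d⟩, ⟨hc, hd⟩, rfl⟩
      exact ⟨c, hc, d, hd, rfl⟩

/-- The linear map that sends a point of the plane to its asymptotic coordinates `(u, v)` with
respect to the sector `S_i`. -/
def sectorCoord (α : ℕ → ℝ) (i : ℕ) : Plane →L[ℝ] ℝ × ℝ :=
  LinearMap.toContinuousLinearMap
    { toFun := fun x =>
        (area x (rayDir α (oddRay i)) / area (rayDir α (evenRay i)) (rayDir α (oddRay i)),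
          area (rayDir α (evenRay i)) x / area (rayDir α (evenRay i)) (rayDir α (oddRay i)))
      map_add' := fun x y => by
        ext <;> simp [area] <;> ring
      map_smul' := fun c x => by
        ext <;> simp [area] <;> ring }

theorem sectorCoord_apply (α : ℕ → ℝ) (i : ℕ) (x : Plane) : sectorCoord α i x =
    (area x (rayDir α (oddRay i)) / area (rayDir α (evenRay i)) (rayDir α (oddRay i)),
      area (rayDir α (evenRay i)) x / area (rayDir α (evenRay i)) (rayDir α (oddRay i))) := rfl

/-- The closed convex cone spanned by the rays that bound the sector `S_i`. -/
def cone (α : ℕ → ℝ) (i : ℕ) : Set Plane :=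
  {x | 0 ≤ (sectorCoord α i x).1 ∧ 0 ≤ (sectorCoord α i x).2}

theorem isClosed_cone (α : ℕ → ℝ) (i : ℕ) : IsClosed (cone α i) := by
  have h : Continuous (sectorCoord α i) := (sectorCoord α i).continuous
  exact (isClosed_le continuous_const (continuous_fst.comp h)).inter
    (isClosed_le continuous_const (continuous_snd.comp h))

theorem convex_cone (α : ℕ → ℝ) (i : ℕ) : Convex ℝ (cone α i) := by
  intro x hx y hy a b ha hb _
  have h1 := hx.1
  have h2 := hx.2
  have h3 := hy.1
  have h4 := hy.2
  simp only [cone, mem_ofPred_eq, map_add, map_smul, Prod.fst_add, Prod.smul_fst, Prod.snd_add,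
    Prod.smul_snd, smul_eq_mul]
  exact ⟨by positivity, by positivity⟩

section Star

variable {m : ℕ} {α : ℕ → ℝ}

theorem rayAngle_succ (α : ℕ → ℝ) (i : ℕ) : rayAngle α (i + 1) = rayAngle α i + α (i + 1) := by
  unfold rayAngle
  rw [Finset.sum_Icc_succ_top (by omega)]

/-- In an even sector `u` runs along the second bounding ray, so the basis of the asymptotic
coordinates is negatively oriented there. -/
theorem area_even_odd {i : ℕ} (hi : 1 ≤ i) :
    area (rayDir α (evenRay i)) (rayDir α (oddRay i)) = (if Even i then -1 else 1) * Real.sin (α i)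
    := by
  obtain ⟨i, rfl⟩ : ∃ k, i = k + 1 := ⟨i - 1, by omega⟩
  unfold evenRay oddRay
  split_ifs
  · rw [rayDir_eq, rayDir_eq, area_unitVec, add_tsub_cancel_right, rayAngle_succ, neg_one_mul,
      ← Real.sin_neg]
    congr 1; ring
  · rw [rayDir_eq, rayDir_eq, area_unitVec, add_tsub_cancel_right, rayAngle_succ, one_mul]
    congr 1; ring

theorem area_even_odd_ne_zero {i : ℕ} (hi : 1 ≤ i) (hα : α i ∈ Ioo 0 Real.pi) :
    area (rayDir α (evenRay i)) (rayDir α (oddRay i)) ≠ 0 := by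
  rw [area_even_odd hi]
  have := (Real.sin_pos_of_mem_Ioo hα).ne'
  split_ifs <;> simpa

/-- Cramer's rule; the determinant is nonzero as the angle lies in `(0, π)`. -/
theorem sectorPoint_sectorCoord {i : ℕ} (hi : 1 ≤ i) (hα : α i ∈ Ioo 0 Real.pi) (x : Plane) :
    sectorPoint α i (sectorCoord α i x) = x := by
  have h := area_even_odd_ne_zero hi hα
  rw [sectorPoint_eq, sectorCoord_apply]
  generalize rayDir α (evenRay i) = a at *
  generalize rayDir α (oddRay i) = b at *
  ext j
  fin_cases j
  · simp only [PiLp.add_apply, PiLp.smul_apply, smul_eq_mul, Fin.zero_eta]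
    field_simp
    simp only [area]
    ring
  · simp only [PiLp.add_apply, PiLp.smul_apply, smul_eq_mul, Fin.mk_one]
    field_simp
    simp only [area]
    ring

theorem sectorCoord_sectorPoint {i : ℕ} (hi : 1 ≤ i) (hα : α i ∈ Ioo 0 Real.pi) (z : ℝ × ℝ) :
    sectorCoord α i (sectorPoint α i z) = z := by
  have h := area_even_odd_ne_zero hi hα
  rw [sectorPoint_eq, sectorCoord_apply]
  generalize rayDir α (evenRay i) = a at *
  generalize rayDir α (oddRay i) = b at *
  have e1 : area (z.1 • a + z.2 • b) b = z.1 * area a b := by simp [area]; ring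
  have e2 : area a (z.1 • a + z.2 • b) = z.2 * area a b := by simp [area]; ring
  rw [e1, e2, mul_div_cancel_right₀ _ h, mul_div_cancel_right₀ _ h]

theorem sectorPoint_mem_cone {i : ℕ} (hi : 1 ≤ i) (hα : α i ∈ Ioo 0 Real.pi) {z : ℝ × ℝ}
    (h1 : 0 ≤ z.1) (h2 : 0 ≤ z.2) : sectorPoint α i z ∈ cone α i := by
  rw [cone, mem_ofPred_eq, sectorCoord_sectorPoint hi hα]
  exact ⟨h1, h2⟩

/-- A cone consists of the points `t • unitVec θ`, where `t ≥ 0` and `θ` lies between the angles of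
the rays that bound it. -/
theorem mem_cone_iff {i : ℕ} (hi : 1 ≤ i) (hα : α i ∈ Ioo 0 Real.pi) {x : Plane} :
    x ∈ cone α i ↔
      ∃ t ≥ (0 : ℝ), ∃ θ ∈ Icc (rayAngle α (i - 1)) (rayAngle α i), x = t • unitVec θ := by
  have hsin := Real.sin_pos_of_mem_Ioo hα
  have hang : rayAngle α i = rayAngle α (i - 1) + α i := by
    conv_lhs => rw [← Nat.sub_add_cancel hi]
    rw [rayAngle_succ, Nat.sub_add_cancel hi]
  have hcone : x ∈ cone α i ↔ 0 ≤ area x (rayDir α i) ∧ 0 ≤ area (rayDir α (i - 1)) x := by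
    rw [cone, mem_ofPred_eq, sectorCoord_apply, area_even_odd hi]
    have hneg : ∀ a b : Plane, area a b = -area b a := fun a b => by simp [area]; ring
    unfold evenRay oddRay
    split_ifs
    · rw [neg_one_mul, div_neg, div_neg, ← neg_div, ← neg_div, ← hneg, ← hneg]
      simp only [le_div_iff₀ hsin, zero_mul]
      exact and_comm
    · rw [one_mul]
      simp only [le_div_iff₀ hsin, zero_mul]
  rw [hcone, rayDir_eq, rayDir_eq]
  have area_smul : ∀ (t : ℝ) (a b : Plane), area (t • a) b = t * area a b ∧
      area a (t • b) = t * area a b := fun t a b => by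
    constructor <;> simp [area] <;> ring
  constructor
  · rintro ⟨h1, h2⟩
    have hle : rayAngle α (i - 1) ≤ rayAngle α i := by linarith [hα.1]
    have hcont : Continuous fun θ => area (unitVec θ) x := by
      simp only [area, unitVec, PiLp.toLp_apply, Matrix.cons_val_zero, Matrix.cons_val_one]
      fun_prop
    -- The area spanned with `x` changes sign between the bounding rays; where it vanishes, the
    -- direction `θ` is parallel to `x`.
    obtain ⟨θ, hθ, h0⟩ := intermediate_value_Icc' hle hcont.continuousOn
      (show (0 : ℝ) ∈ _ from ⟨by
        have : area (unitVec (rayAngle α i)) x = -area x (unitVec (rayAngle α i)) := by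
          simp [area]; ring
        linarith, h2⟩)
    set t : ℝ := x 0 * Real.cos θ + x 1 * Real.sin θ with ht
    have hx : x = t • unitVec θ := by
      have hs := Real.sin_sq_add_cos_sq θ
      simp only [area, unitVec, PiLp.toLp_apply, Matrix.cons_val_zero, Matrix.cons_val_one] at h0
      ext j
      fin_cases j
      · simp [unitVec, ht]
        linear_combination (-Real.sin θ) * h0 - x 0 * hs
      · simp [unitVec, ht]
        linear_combination (Real.cos θ) * h0 - x 1 * hs
    refine ⟨t, ?_, θ, hθ, hx⟩
    rw [hx, (area_smul _ _ _).1, area_unitVec] at h1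
    rw [hx, (area_smul _ _ _).2, area_unitVec] at h2
    -- A negative `t` violates `h1` if `θ` is the lower angle, since then the sine is that of `α i`,
    -- and violates `h2` otherwise.
    by_contra! htneg
    rcases eq_or_lt_of_le hθ.1 with h | h
    · have : rayAngle α i - θ = α i := by linarith
      rw [this] at h1
      nlinarith
    · have : 0 < Real.sin (θ - rayAngle α (i - 1)) :=
        Real.sin_pos_of_pos_of_lt_pi (by linarith) (by linarith [hθ.2, hα.2])
      nlinarith
  · rintro ⟨t, ht, θ, hθ, rfl⟩
    rw [(area_smul _ _ _).1, (area_smul _ _ _).2, area_unitVec, area_unitVec]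
    constructor
    · exact mul_nonneg ht (Real.sin_nonneg_of_nonneg_of_le_pi (by linarith [hθ.2])
        (by linarith [hθ.1, hα.2]))
    · exact mul_nonneg ht (Real.sin_nonneg_of_nonneg_of_le_pi (by linarith [hθ.1])
        (by linarith [hθ.2, hα.2]))

theorem exists_eq_smul_unitVec (x : Plane) :
    ∃ t ≥ (0 : ℝ), ∃ θ ∈ Icc 0 (2 * Real.pi), x = t • unitVec θ := by
  let z : ℂ := ⟨x 0, x 1⟩
  have h1 : x = ‖z‖ • unitVec z.arg := by
    ext j
    fin_cases j
    · simp [unitVec, z]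
    · simp [unitVec, z]
  rcases le_or_gt 0 z.arg with h | h
  · exact ⟨‖z‖, norm_nonneg _, z.arg, ⟨h, by linarith [Complex.arg_le_pi z, Real.pi_pos]⟩, h1⟩
  · refine ⟨‖z‖, norm_nonneg _, z.arg + 2 * Real.pi,
      ⟨by linarith [Complex.neg_pi_lt_arg z, Real.pi_pos], by linarith⟩, ?_⟩
    rw [h1]
    simp [unitVec]

theorem rayAngle_lt_rayAngle (hα : ∀ i ∈ Finset.Icc 1 (2 * m), α i ∈ Ioo 0 Real.pi) {i j : ℕ}
    (hij : i < j) (hj : j ≤ 2 * m) : rayAngle α i < rayAngle α j := by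
  induction j, hij using Nat.le_induction with
  | base =>
    rw [rayAngle_succ]
    linarith [(hα (i + 1) (Finset.mem_Icc.2 ⟨by omega, hj⟩)).1]
  | succ j hij ih =>
    rw [rayAngle_succ]
    linarith [ih (by omega), (hα (j + 1) (Finset.mem_Icc.2 ⟨by omega, hj⟩)).1]

theorem rayAngle_le_rayAngle (hα : ∀ i ∈ Finset.Icc 1 (2 * m), α i ∈ Ioo 0 Real.pi) {i j : ℕ}
    (hij : i ≤ j) (hj : j ≤ 2 * m) : rayAngle α i ≤ rayAngle α j := by
  rcases hij.eq_or_lt with rfl | h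
  · exact le_rfl
  · exact (rayAngle_lt_rayAngle hα h hj).le

theorem rayAngle_zero (α : ℕ → ℝ) : rayAngle α 0 = 0 := by simp [rayAngle]

theorem rayDir_rayIndex (hsum : ∑ i ∈ Finset.Icc 1 (2 * m), α i = 2 * Real.pi) (k : ℕ) :
    rayDir α (rayIndex m k) = rayDir α k := by
  unfold rayIndex
  split_ifs with h
  · have h1 : rayAngle α (2 * m) = 2 * Real.pi := hsum
    rw [h, rayDir_eq, rayDir_eq, h1, rayAngle_zero]
    simp [unitVec]
  · rfl

/-- The cones of a star cover the plane. -/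
theorem exists_mem_cone (hm : 1 ≤ 2 * m) (hα : ∀ i ∈ Finset.Icc 1 (2 * m), α i ∈ Ioo 0 Real.pi)
    (hsum : ∑ i ∈ Finset.Icc 1 (2 * m), α i = 2 * Real.pi) (x : Plane) :
    ∃ i ∈ Finset.Icc 1 (2 * m), x ∈ cone α i := by
  obtain ⟨t, ht, θ, hθ, rfl⟩ := exists_eq_smul_unitVec x
  have hlast : θ ≤ rayAngle α (2 * m) := hθ.2.trans hsum.ge
  have hex : ∃ k, θ ≤ rayAngle α k := ⟨_, hlast⟩
  classical
  obtain ⟨i, hi, h1, h2⟩ : ∃ i ∈ Finset.Icc 1 (2 * m),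
      rayAngle α (i - 1) ≤ θ ∧ θ ≤ rayAngle α i := by
    -- The cone is the one that ends at the first ray with angle at least `θ`; index `0` means `θ =
    -- 0`, which belongs to the first cone.
    rcases Nat.eq_zero_or_pos (Nat.find hex) with h | h
    · have h0 := Nat.find_spec hex
      rw [h, rayAngle_zero] at h0
      have h1 : (1 : ℕ) ∈ Finset.Icc 1 (2 * m) := Finset.mem_Icc.2 ⟨le_rfl, hm⟩
      have h2 := rayAngle_lt_rayAngle hα (Nat.zero_lt_one) hm
      rw [rayAngle_zero] at h2
      exact ⟨1, h1, by rw [Nat.sub_self, rayAngle_zero]; exact hθ.1, h0.trans h2.le⟩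
    · exact ⟨Nat.find hex, Finset.mem_Icc.2 ⟨h, Nat.find_min' hex hlast⟩,
        (not_le.1 (Nat.find_min hex (Nat.sub_lt h Nat.zero_lt_one))).le, Nat.find_spec hex⟩
  exact ⟨i, hi, (mem_cone_iff (Finset.mem_Icc.1 hi).1 (hα i hi)).2 ⟨t, ht, θ, ⟨h1, h2⟩, rfl⟩⟩

/-- Distinct cones of a star meet in a common bounding ray or in the origin. -/
theorem cone_inter_cone (hα : ∀ i ∈ Finset.Icc 1 (2 * m), α i ∈ Ioo 0 Real.pi)
    (hsum : ∑ i ∈ Finset.Icc 1 (2 * m), α i = 2 * Real.pi) {i j : ℕ}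
    (hi : i ∈ Finset.Icc 1 (2 * m)) (hj : j ∈ Finset.Icc 1 (2 * m)) (hij : i < j) {x : Plane}
    (hxi : x ∈ cone α i) (hxj : x ∈ cone α j) :
    x = 0 ∨ ∃ t ≥ (0 : ℝ), (j = i + 1 ∧ x = t • rayDir α i) ∨
      (i = 1 ∧ j = 2 * m ∧ x = t • rayDir α 0) := by
  have hi' := Finset.mem_Icc.1 hi
  have hj' := Finset.mem_Icc.1 hj
  obtain ⟨t, ht, θ, hθ, hx⟩ := (mem_cone_iff hi'.1 (hα i hi)).1 hxi
  obtain ⟨t', ht', θ', hθ', hx'⟩ := (mem_cone_iff hj'.1 (hα j hj)).1 hxj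
  refine or_iff_not_imp_left.2 fun hx0 => ⟨t, ht, ?_⟩
  have htt : t = t' := by
    have h1 := congrArg norm hx
    have h2 := congrArg norm hx'
    rw [norm_smul, norm_unitVec, mul_one, Real.norm_of_nonneg ht] at h1
    rw [norm_smul, norm_unitVec, mul_one, Real.norm_of_nonneg ht'] at h2
    exact h1.symm.trans h2
  have ht0 : t ≠ 0 := fun h => hx0 (by rw [hx, h, zero_smul])
  have huv : unitVec θ = unitVec θ' := by
    rw [hx, ← htt] at hx'
    exact smul_right_injective _ ht0 hx'
  have hcos : Real.cos (θ' - θ) = 1 := by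
    have h0 : Real.cos θ = Real.cos θ' := congrFun (congrArg WithLp.ofLp huv) 0
    have h1 : Real.sin θ = Real.sin θ' := congrFun (congrArg WithLp.ofLp huv) 1
    rw [Real.cos_sub, h0, h1]
    nlinarith [Real.sin_sq_add_cos_sq θ']
  obtain ⟨n, hn⟩ := (Real.cos_eq_one_iff _).1 hcos
  have hle1 : rayAngle α i ≤ rayAngle α (j - 1) := rayAngle_le_rayAngle hα (by omega) (by omega)
  have hle2 : rayAngle α 0 ≤ rayAngle α (i - 1) :=
    rayAngle_le_rayAngle hα (Nat.zero_le _) (by omega)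
  have hle3 : rayAngle α j ≤ rayAngle α (2 * m) := rayAngle_le_rayAngle hα hj'.2 le_rfl
  have hlast : rayAngle α (2 * m) = 2 * Real.pi := hsum
  rw [rayAngle_zero] at hle2
  have hpi := Real.pi_pos
  have hn0 : -1 < n := by
    have : (-1 : ℝ) < n := by nlinarith [hθ.2, hθ'.1]
    exact_mod_cast this
  have hn1 : n < 2 := by
    have : (n : ℝ) < 2 := by nlinarith [hθ.1, hθ'.2]
    exact_mod_cast this
  -- Here `θ' - θ = 2π n`. For `n = 0` both angles equal that of a ray between consecutive cones;
  -- for `n = 1` they are `0` and `2π`, and the cones are the first and the last.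
  obtain rfl | rfl : n = 0 ∨ n = 1 := by omega
  · left
    have hji : j = i + 1 := by
      by_contra hne
      have := rayAngle_lt_rayAngle hα (show i < j - 1 by omega) (by omega)
      push_cast at hn
      linarith [hθ.2, hθ'.1]
    refine ⟨hji, ?_⟩
    subst hji
    rw [add_tsub_cancel_right] at hθ'
    push_cast at hn
    have : θ = rayAngle α i := le_antisymm hθ.2 (by linarith [hθ'.1])
    rw [hx, this, rayDir_eq]
  · right
    push_cast at hn
    have hθ0 : θ = 0 := by linarith [hθ.1, hθ'.2]
    refine ⟨?_, ?_, by rw [hx, hθ0, rayDir_eq, rayAngle_zero]⟩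
    · by_contra hne
      have := rayAngle_lt_rayAngle hα (show 0 < i - 1 by omega) (by omega)
      rw [rayAngle_zero] at this
      linarith [hθ.1]
    · by_contra hne
      have := rayAngle_lt_rayAngle hα (show j < 2 * m by omega) le_rfl
      linarith [hθ'.2]

/-- Data on the sectors of a star that are determined on the rays by the ray agree on the
intersections of the sectors. -/
theorem eq_of_mem_cones {X : Type*} (hα : ∀ i ∈ Finset.Icc 1 (2 * m), α i ∈ Ioo 0 Real.pi)
    (hsum : ∑ i ∈ Finset.Icc 1 (2 * m), α i = 2 * Real.pi) {f : ℕ → Plane → X} {γ : ℕ → ℝ → X}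
    {x₀ : X} (h0 : ∀ i ∈ Finset.Icc 1 (2 * m), f i 0 = x₀)
    (hf : ∀ i ∈ Finset.Icc 1 (2 * m), ∀ t ≥ (0 : ℝ),
      f i (sectorPoint α i (t, 0)) = γ (rayIndex m (evenRay i)) t ∧
      f i (sectorPoint α i (0, t)) = γ (rayIndex m (oddRay i)) t)
    {i j : ℕ} (hi : i ∈ Finset.Icc 1 (2 * m)) (hj : j ∈ Finset.Icc 1 (2 * m)) {x : Plane}
    (hxi : x ∈ cone α i) (hxj : x ∈ cone α j) : f i x = f j x := by
  have hray : ∀ i ∈ Finset.Icc 1 (2 * m), ∀ t ≥ (0 : ℝ),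
      f i (t • rayDir α i) = γ (rayIndex m i) t ∧
      f i (t • rayDir α (i - 1)) = γ (rayIndex m (i - 1)) t := by
    intro i hi t ht
    obtain ⟨h1, h2⟩ := hf i hi t ht
    rw [sectorPoint_eq] at h1 h2
    simp only [zero_smul, add_zero, zero_add] at h1 h2
    unfold evenRay at h1
    unfold oddRay at h2
    split_ifs at h1 h2
    · exact ⟨h1, h2⟩
    · exact ⟨h2, h1⟩
  wlog hij : i < j generalizing i j
  · rcases (not_lt.1 hij).eq_or_lt with rfl | h
    · rfl
    · exact (this hj hi hxj hxi h).symm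
  rcases cone_inter_cone hα hsum hi hj hij hxi hxj with rfl | ⟨t, ht, ⟨rfl, rfl⟩ | ⟨rfl, rfl, rfl⟩⟩
  · rw [h0 i hi, h0 j hj]
  · rw [(hray i hi t ht).1]
    have h := (hray (i + 1) hj t ht).2
    rw [add_tsub_cancel_right] at h
    exact h.symm
  · have h1 := (hray 1 hi t ht).2
    rw [Nat.sub_self] at h1
    rw [h1]
    have h2 : rayDir α 0 = rayDir α (2 * m) := by
      rw [← rayDir_rayIndex hsum 0]; simp [rayIndex]
    rw [h2, (hray (2 * m) hj t ht).1]
    simp [rayIndex]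

/-- Replacing ray `0` by ray `2m` preserves parity, so every sector has one even ray for `u` and one
odd ray for `v`. -/
theorem rayIndex_mem (hm : 1 ≤ 2 * m) {i : ℕ} (hi : i ∈ Finset.Icc 1 (2 * m)) :
    rayIndex m (evenRay i) ∈ Finset.Icc 1 (2 * m) ∧ rayIndex m (oddRay i) ∈ Finset.Icc 1 (2 * m) ∧
      Even (rayIndex m (evenRay i)) ∧ ¬ Even (rayIndex m (oddRay i)) := by
  simp only [Finset.mem_Icc, Nat.even_iff] at hi ⊢
  unfold rayIndex evenRay oddRay
  simp only [Nat.even_iff]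
  split_ifs <;> refine ⟨?_, ?_, ?_, ?_⟩ <;> omega

/-- A star meets each of its cones in the corresponding sector. -/
theorem mem_mStar_iff (hm : 1 ≤ 2 * m) (hα : ∀ i ∈ Finset.Icc 1 (2 * m), α i ∈ Ioo 0 Real.pi)
    (hsum : ∑ i ∈ Finset.Icc 1 (2 * m), α i = 2 * Real.pi) {l : ℕ → ℝ}
    (hl : ∀ i ∈ Finset.Icc 1 (2 * m), 0 < l i) {i : ℕ} (hi : i ∈ Finset.Icc 1 (2 * m)) {x : Plane}
    (hx : x ∈ cone α i) : x ∈ mStar m α l ↔ sectorCoord α i x ∈ sectorRect m l i := by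
  have hsec : ∀ j ∈ Finset.Icc 1 (2 * m), ∀ y,
      y ∈ sector m α l j ↔ sectorCoord α j y ∈ sectorRect m l j := by
    intro j hj y
    have hj' := Finset.mem_Icc.1 hj
    rw [sector_eq]
    constructor
    · rintro ⟨z, hz, rfl⟩
      rwa [sectorCoord_sectorPoint hj'.1 (hα j hj)]
    · exact fun h => ⟨_, h, sectorPoint_sectorCoord hj'.1 (hα j hj) y⟩
  have hrect : ∀ j ∈ Finset.Icc 1 (2 * m), 0 < rayLength m l (evenRay j) ∧
      0 < rayLength m l (oddRay j) := fun j hj => by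
    rw [rayLength_eq, rayLength_eq]
    exact ⟨hl _ (rayIndex_mem hm hj).1, hl _ (rayIndex_mem hm hj).2.1⟩
  -- Lying in the coordinate rectangle is treated as `Prop`-valued data on the cones. On ray `k` it
  -- means `t < l k`, whichever cone is used, so the gluing lemma applies.
  have key : ∀ j ∈ Finset.Icc 1 (2 * m), x ∈ cone α j →
      (sectorCoord α j x ∈ sectorRect m l j) = (sectorCoord α i x ∈ sectorRect m l i) := by
    intro j hj hxj
    refine eq_of_mem_cones hα hsum (X := Prop)
      (f := fun j y => sectorCoord α j y ∈ sectorRect m l j) (γ := fun k t => t < l k)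
      (x₀ := True) (fun j hj => ?_) (fun j hj t ht => ?_) hj hi hxj hx
    · rw [map_zero, sectorRect_eq]
      simpa using hrect j hj
    · rw [sectorCoord_sectorPoint (Finset.mem_Icc.1 hj).1 (hα j hj),
        sectorCoord_sectorPoint (Finset.mem_Icc.1 hj).1 (hα j hj), sectorRect_eq,
        rayLength_eq, rayLength_eq]
      have := hrect j hj
      rw [rayLength_eq, rayLength_eq] at this
      simp [this, ht.le]
  unfold mStar
  simp only [mem_iUnion]
  constructor
  · rintro ⟨j, hj, hxj⟩
    rw [hsec j hj] at hxj
    refine (key j hj ?_) ▸ hxj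
    rw [sectorRect_eq] at hxj
    exact ⟨hxj.1.1, hxj.2.1⟩
  · exact fun h => ⟨i, hi, (hsec i hi x).2 h⟩

/-- The complement is a finite union of closed sets: in each cone, what lies outside the coordinate
box. Openness makes the star an admissible chart domain. -/
theorem isOpen_mStar (hm : 1 ≤ 2 * m) (hα : ∀ i ∈ Finset.Icc 1 (2 * m), α i ∈ Ioo 0 Real.pi)
    (hsum : ∑ i ∈ Finset.Icc 1 (2 * m), α i = 2 * Real.pi) {l : ℕ → ℝ}
    (hl : ∀ i ∈ Finset.Icc 1 (2 * m), 0 < l i) : IsOpen (mStar m α l) := by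
  have h : (mStar m α l)ᶜ = ⋃ i ∈ Finset.Icc 1 (2 * m), cone α i ∩
      (sectorCoord α i ⁻¹' (Iio (rayLength m l (evenRay i)) ×ˢ Iio (rayLength m l (oddRay i))))ᶜ := by
    ext x
    simp only [mem_iUnion, mem_compl_iff, mem_inter_iff]
    constructor
    · intro hx
      obtain ⟨i, hi, hxi⟩ := exists_mem_cone hm hα hsum x
      refine ⟨i, hi, hxi, fun h => hx ?_⟩
      rw [mem_mStar_iff hm hα hsum hl hi hxi, sectorRect_eq]
      exact ⟨⟨hxi.1, h.1⟩, ⟨hxi.2, h.2⟩⟩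
    · rintro ⟨i, hi, hxi, hx⟩ hxT
      rw [mem_mStar_iff hm hα hsum hl hi hxi, sectorRect_eq] at hxT
      exact hx ⟨hxT.1.2, hxT.2.2⟩
  rw [← isClosed_compl_iff, h]
  exact (Finset.finite_toSet _).isClosed_biUnion fun i _ => (isClosed_cone α i).inter
    ((isOpen_Iio.prod isOpen_Iio).preimage (sectorCoord α i).continuous).isClosed_compl

theorem mStar_subset_ball (hm : 1 ≤ 2 * m) {l : ℕ → ℝ} {δ : ℝ}
    (hl : ∀ i ∈ Finset.Icc 1 (2 * m), l i < δ) : mStar m α l ⊆ ball 0 (2 * δ) := by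
  intro x hx
  unfold mStar at hx
  simp only [mem_iUnion] at hx
  obtain ⟨i, hi, hx⟩ := hx
  rw [sector_eq, sectorRect_eq, rayLength_eq, rayLength_eq] at hx
  obtain ⟨z, hz, rfl⟩ := hx
  rw [mem_ball_zero_iff, sectorPoint_eq]
  refine (norm_add_le _ _).trans_lt ?_
  rw [norm_smul, norm_smul, rayDir_eq, rayDir_eq, norm_unitVec, norm_unitVec,
    Real.norm_of_nonneg hz.1.1, Real.norm_of_nonneg hz.2.1]
  linarith [hz.1.2, hz.2.2, hl _ (rayIndex_mem hm hi).1, hl _ (rayIndex_mem hm hi).2.1]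

end Star

/-! ### Assembly of the saddle -/

theorem exists_pos_forall_le {ι : Type*} (I : Finset ι) {f : ι → ℝ} (hf : ∀ i ∈ I, 0 < f i) :
    ∃ ε > 0, ∀ i ∈ I, ε ≤ f i := by
  have h : ∀ᶠ ε in 𝓝[>] (0 : ℝ), ∀ i ∈ I, ε ∈ Ioc 0 (f i) :=
    (Filter.eventually_all_finset I).2 fun i hi => Ioc_mem_nhdsGT (hf i hi)
  obtain ⟨ε, h1, h2⟩ := (h.and self_mem_nhdsWithin).exists
  exact ⟨ε, h2, fun i hi => (h1 i hi).2⟩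

theorem inner_cross_left (x n : Space) : inner ℝ (cross x n) n = 0 := by
  rw [space_inner, cross_apply_zero, cross_apply_one, cross_apply_two]
  ring

theorem cos_sin_ne_zero (θ : ℝ) : (!₂[Real.cos θ, Real.sin θ, 0] : Space) ≠ 0 := by
  intro h
  have h0 : Real.cos θ = 0 := congrFun (congrArg WithLp.ofLp h) 0
  have h1 : Real.sin θ = 0 := congrFun (congrArg WithLp.ofLp h) 1
  have := Real.sin_sq_add_cos_sq θ
  rw [h0, h1] at this
  norm_num at this

theorem HasMixedPartials.fderiv_comp_sectorCoord {E : Type*} [NormedAddCommGroup E]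
    [NormedSpace ℝ E] {f fu fv fuv : ℝ × ℝ → E} (h : HasMixedPartials f fu fv fuv) (α : ℕ → ℝ)
    (i : ℕ) (x w : Plane) : fderiv ℝ (fun x => f (sectorCoord α i x)) x w =
      (sectorCoord α i w).1 • fu (sectorCoord α i x)
        + (sectorCoord α i w).2 • fv (sectorCoord α i x) := by
  have h1 := (h.hasFDerivAt (sectorCoord α i x)).comp x (sectorCoord α i).hasFDerivAt
  have h2 : fderiv ℝ (fun x => f (sectorCoord α i x)) x = _ := h1.fderiv
  rw [h2]
  simp

theorem proposition1 (m : ℕ) (hm : 4 ≤ 2 * m) (L : ℝ) (hL : 0 < L)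
    (κ : ℕ → ℝ → ℝ) (hκ : ∀ i ∈ Finset.Icc 1 (2 * m), ContDiffOn ℝ ∞ (κ i) (Set.Ico 0 L))
    (α : ℕ → ℝ) (hα : ∀ i ∈ Finset.Icc 1 (2 * m), α i ∈ Set.Ioo 0 Real.pi)
    (hsum : ∑ i ∈ Finset.Icc 1 (2 * m), α i = 2 * Real.pi) :
    ∃ δ ∈ Set.Ioc 0 L, ∀ l : ℕ → ℝ, (∀ i ∈ Finset.Icc 1 (2 * m), l i ∈ Set.Ioo 0 δ) →
      ∃ (F : ℕ → ℝ → Matrix (Fin 3) (Fin 3) ℝ) (r N : Plane → Space),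
        IsSaddle m α l r N ∧ r 0 = 0 ∧ N 0 = e₃ ∧
        ∀ i ∈ Finset.Icc 1 (2 * m),
          IsFrenetFrame (l i) (κ i) (if Even i then -1 else 1) (F i) ∧
          frameTangent (F i 0) = horizontal (rayDir α i) ∧
          frameNormal (F i 0) = e₃ ∧
          ∀ t ∈ Set.Ico 0 (l i),
            HasDerivWithinAt (fun s : ℝ => r (s • rayDir α i)) (frameTangent (F i t))
              (Set.Ico 0 (l i)) t ∧
            N (t • rayDir α i) = frameNormal (F i t) := by
  have hm1 : 1 ≤ 2 * m := by omega
  set I := Finset.Icc 1 (2 * m) with hI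
  have hcurve : ∀ k ∈ I, ∃ η ∈ Ioo 0 L, ∃ F a p g,
      IsAsymptoticCurve (κ k) (if Even k then 1 else -1) (rayAngle α k) η F a p g := fun k hk =>
    exists_isAsymptoticCurve hL (hκ k hk).continuousOn (by split_ifs <;> simp) _
  choose! η hη F a p g hc using hcurve
  have hfront : ∀ i ∈ I, ∃ ρ > 0, ∃ N Nu Nv Nuv r ru rv ruv,
      IsFrontOn ρ N Nu Nv Nuv r ru rv ruv ∧
      (∀ t, N (t, 0) = p (rayIndex m (evenRay i)) t) ∧
      (∀ t, N (0, t) = p (rayIndex m (oddRay i)) t) ∧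
      (∀ t, r (t, 0) = g (rayIndex m (evenRay i)) t) ∧
      (∀ t, r (0, t) = g (rayIndex m (oddRay i)) t) ∧
      ru 0 = horizontal (rayDir α (evenRay i)) ∧ rv 0 = horizontal (rayDir α (oddRay i)) := by
    intro i hi
    obtain ⟨h1, h2, h3, h4⟩ := rayIndex_mem hm1 hi
    have c1 := hc _ h1
    have c2 := hc _ h2
    rw [if_pos h3] at c1
    rw [if_neg h4] at c2
    rw [← rayDir_rayIndex hsum (evenRay i), ← rayDir_rayIndex hsum (oddRay i)]
    exact exists_isFrontOn (hη _ h1).1 (hη _ h2).1 c1 c2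
  choose! ρ hρ n nu nv nuv f fu fv fuv hf hnu hnv hfu hfv hfu0 hfv0 using hfront
  have hIpos : ∀ i ∈ I, 1 ≤ i := fun i hi => (Finset.mem_Icc.1 hi).1
  -- The glued maps use an arbitrary cone containing the point; agreement on intersections makes the
  -- choice immaterial.
  choose c hcI hcone using exists_mem_cone hm1 hα hsum
  let R : ℕ → Plane → Space := fun i x => f i (sectorCoord α i x)
  let M : ℕ → Plane → Space := fun i x => n i (sectorCoord α i x)
  let r : Plane → Space := fun x => R (c x) x
  let N : Plane → Space := fun x => M (c x) x
  have hR0 : ∀ i ∈ I, R i 0 = 0 := fun i hi => by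
    have h1 := (rayIndex_mem hm1 hi).1
    simp only [R, map_zero]
    exact (hfu i hi 0).trans (hc _ h1).curve_zero
  have hM0 : ∀ i ∈ I, M i 0 = e₃ := fun i hi => by
    have h1 := (rayIndex_mem hm1 hi).1
    simp only [M, map_zero]
    exact (hnu i hi 0).trans (hc _ h1).normal_zero
  have hRpt : ∀ i ∈ I, ∀ z, R i (sectorPoint α i z) = f i z := fun i hi z => by
    simp only [R, sectorCoord_sectorPoint (hIpos i hi) (hα i hi)]
  have hMpt : ∀ i ∈ I, ∀ z, M i (sectorPoint α i z) = n i z := fun i hi z => by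
    simp only [M, sectorCoord_sectorPoint (hIpos i hi) (hα i hi)]
  have hrR : ∀ i ∈ I, EqOn r (R i) (cone α i) := fun i hi x hx =>
    eq_of_mem_cones hα hsum hR0 (γ := g)
      (fun j hj t _ => ⟨(hRpt j hj _).trans (hfu j hj t), (hRpt j hj _).trans (hfv j hj t)⟩)
      (hcI x) hi (hcone x) hx
  have hNM : ∀ i ∈ I, EqOn N (M i) (cone α i) := fun i hi x hx =>
    eq_of_mem_cones hα hsum hM0 (γ := p)
      (fun j hj t _ => ⟨(hMpt j hj _).trans (hnu j hj t), (hMpt j hj _).trans (hnv j hj t)⟩)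
      (hcI x) hi (hcone x) hx
  have hr0 : r 0 = 0 := hR0 _ (hcI 0)
  have hN0 : N 0 = e₃ := hM0 _ (hcI 0)
  obtain ⟨ρ₀, hρ₀, hcoord⟩ : ∃ ρ₀ > 0, ∀ x ∈ ball (0 : Plane) ρ₀, ∀ i ∈ I,
      (sectorCoord α i x).1 < ρ i ∧ (sectorCoord α i x).2 < ρ i := by
    refine Metric.eventually_nhds_iff_ball.1 ((Filter.eventually_all_finset I).2 fun i hi => ?_)
    have h1 : Continuous (sectorCoord α i) := (sectorCoord α i).continuous
    exact ((continuous_fst.comp h1).continuousAt.eventually_lt_const (by simpa using hρ i hi)).and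
      ((continuous_snd.comp h1).continuousAt.eventually_lt_const (by simpa using hρ i hi))
  have hbox : ∀ i ∈ I, ∀ x ∈ cone α i ∩ ball 0 ρ₀,
      (sectorCoord α i x).1 ∈ Icc 0 (ρ i) ∧ (sectorCoord α i x).2 ∈ Icc 0 (ρ i) :=
    fun i hi x hx => ⟨⟨hx.1.1, (hcoord x hx.2 i hi).1.le⟩, ⟨hx.1.2, (hcoord x hx.2 i hi).2.le⟩⟩
  obtain ⟨ρ', hρ', himm⟩ := exists_ball_isC11Immersion I (fun i _ => isClosed_cone α i)
    (fun i _ => convex_cone α i) (exists_mem_cone hm1 hα hsum)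
    (fun i hi => (hf i hi).front.contDiff.comp (sectorCoord α i).contDiff)
    (fun i hi => (hf i hi).normal.contDiff.comp (sectorCoord α i).contDiff) hrR hNM hρ₀
    (fun x hx => by
      have h := hbox _ (hcI x) x ⟨hcone x, hx⟩
      exact (hf _ (hcI x)).norm_normal _ h.1 _ h.2)
    (fun i hi x hx w => by
      have h := hbox i hi x hx
      have hu := (hf i hi).lelieuvre_u _ h.1 _ h.2
      have hv := (hf i hi).lelieuvre_v _ h.1 _ h.2
      have e := (hf i hi).front.fderiv_comp_sectorCoord α i x w
      rw [Prod.mk.eta] at hu hv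
      rw [hNM i hi hx.1]
      simp only [M]
      refine (congrArg (fun y => inner ℝ y (n i (sectorCoord α i x))) e).trans ?_
      rw [hu, hv, inner_add_left, inner_smul_left, inner_smul_left, inner_neg_left,
        inner_cross_left, inner_cross_left]
      simp) hN0
    -- At the vertex `r_u` and `r_v` are the horizontal ray directions, so the shadow of the
    -- differential rebuilds `w` from its own sector coordinates.
    (fun i hi w => by
      have e := (hf i hi).front.fderiv_comp_sectorCoord α i 0 w
      refine (congrArg shadow e).trans ?_
      rw [map_zero, hfu0 i hi, hfv0 i hi, map_add, map_smul, map_smul]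
      conv_rhs => rw [← sectorPoint_sectorCoord (hIpos i hi) (hα i hi) w, sectorPoint_eq]
      have hsh : ∀ y : Plane, shadow (horizontal y) = y := fun y => by
        ext j; fin_cases j <;> simp [horizontal]
      rw [hsh, hsh])
  obtain ⟨ε, hε, hreg⟩ : ∃ ε > 0, ∀ z ∈ ball (0 : ℝ × ℝ) ε, ∀ i ∈ I, fu i z ≠ 0 ∧ fv i z ≠ 0 := by
    refine Metric.eventually_nhds_iff_ball.1 ((Filter.eventually_all_finset I).2 fun i hi => ?_)
    refine ((hf i hi).front.continuous_u.continuousAt.eventually_ne ?_).and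
      ((hf i hi).front.continuous_v.continuousAt.eventually_ne ?_)
    · rw [hfu0 i hi]; exact cos_sin_ne_zero _
    · rw [hfv0 i hi]; exact cos_sin_ne_zero _
  obtain ⟨ε₁, hε₁, hle₁⟩ := exists_pos_forall_le I hρ
  obtain ⟨ε₂, hε₂, hle₂⟩ := exists_pos_forall_le I fun i hi => (hη i hi).1
  -- The star lies in the ball of radius `2δ`, whence `ρ' / 2`. The bound `ε` keeps `r_u` and `r_v`
  -- nonzero, `ε₁` keeps the rectangles inside the squares of the fronts, and `ε₂` keeps the rays
  -- inside the domains of the frames.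
  refine ⟨min L (min (ρ' / 2) (min ε (min ε₁ ε₂))), ⟨by positivity, min_le_left _ _⟩,
    fun l hl => ?_⟩
  simp only [mem_Ioo, lt_min_iff] at hl
  have hlpos : ∀ i ∈ I, 0 < l i := fun i hi => (hl i hi).1
  refine ⟨F, r, N, ⟨himm _ (isOpen_mStar hm1 hα hsum hlpos) ?_, fun i hi => ?_⟩, hr0, hN0,
    fun i hi => ?_⟩
  · have h := mStar_subset_ball (α := α) hm1 (l := l) (δ := ρ' / 2) fun i hi => (hl i hi).2.2.1
    rwa [mul_div_cancel₀ _ two_ne_zero] at h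
  · obtain ⟨h1, h2, -, -⟩ := rayIndex_mem hm1 hi
    rw [sectorRect_eq, rayLength_eq, rayLength_eq]
    have hpt : ∀ z ∈ Ico 0 (l (rayIndex m (evenRay i))) ×ˢ Ico 0 (l (rayIndex m (oddRay i))),
        sectorPoint α i z ∈ cone α i := fun z hz =>
      sectorPoint_mem_cone (hIpos i hi) (hα i hi) hz.1.1 hz.2.1
    have hball : ∀ z ∈ Ico 0 (l (rayIndex m (evenRay i))) ×ˢ Ico 0 (l (rayIndex m (oddRay i))),
        z ∈ ball (0 : ℝ × ℝ) ε := fun z hz => by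
      rw [mem_ball_zero_iff, Prod.norm_def, Real.norm_of_nonneg hz.1.1,
        Real.norm_of_nonneg hz.2.1]
      exact max_lt (hz.1.2.trans (hl _ h1).2.2.2.1) (hz.2.2.trans (hl _ h2).2.2.2.1)
    exact (hf i hi).isPSFront ((hl _ h1).2.2.2.2.1.le.trans (hle₁ i hi))
      ((hl _ h2).2.2.2.2.1.le.trans (hle₁ i hi))
      (fun z hz => (hrR i hi (hpt z hz)).trans (hRpt i hi z))
      (fun z hz => (hNM i hi (hpt z hz)).trans (hMpt i hi z))
      (fun z hz => (hreg z (hball z hz) i hi).1) (fun z hz => (hreg z (hball z hz) i hi).2)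
  · have hlη : l i ≤ η i := (hl i hi).2.2.2.2.2.le.trans (hle₂ i hi)
    have h0 : (0 : ℝ) ∈ Icc 0 (η i) := left_mem_Icc.2 (hη i hi).1.le
    have hray : ∀ t ≥ 0, r (t • rayDir α i) = g i t ∧ N (t • rayDir α i) = p i t := by
      intro t ht
      have hidx : rayIndex m i = i := if_neg (by have := hIpos i hi; omega)
      by_cases hev : Even i
      · have hev' : evenRay i = i := if_pos hev
        have e : t • rayDir α i = sectorPoint α i (t, 0) := by
          rw [sectorPoint_eq, hev']; simp
        have hmem : sectorPoint α i (t, 0) ∈ cone α i :=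
          sectorPoint_mem_cone (hIpos i hi) (hα i hi) ht le_rfl
        rw [e, hrR i hi hmem, hNM i hi hmem, hRpt i hi, hMpt i hi, hfu i hi, hnu i hi, hev', hidx]
        exact ⟨rfl, rfl⟩
      · have hodd : oddRay i = i := if_neg hev
        have e : t • rayDir α i = sectorPoint α i (0, t) := by
          rw [sectorPoint_eq, hodd]; simp
        have hmem : sectorPoint α i (0, t) ∈ cone α i :=
          sectorPoint_mem_cone (hIpos i hi) (hα i hi) le_rfl ht
        rw [e, hrR i hi hmem, hNM i hi hmem, hRpt i hi, hMpt i hi, hfv i hi, hnv i hi, hodd, hidx]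
        exact ⟨rfl, rfl⟩
    refine ⟨?_, ?_, ?_, fun t ht => ⟨?_, ?_⟩⟩
    · have h := (hc i hi).isFrenetFrame (l i) hlη
      split_ifs at h ⊢ with hev
      · exact h
      · rwa [neg_neg] at h
    · rw [(hc i hi).frameTangent_zero]
      rfl
    · rw [(hc i hi).frameNormal_eq 0 h0, (hc i hi).normal_zero]
    · rw [(hc i hi).frameTangent_eq t ⟨ht.1, ht.2.le.trans hlη⟩]
      exact ((hc i hi).hasDerivAt_curve t).hasDerivWithinAt.congr
        (fun s hs => (hray s hs.1).1) (hray t ht.1).1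
    · rw [(hc i hi).frameNormal_eq t ⟨ht.1, ht.2.le.trans hlη⟩, (hray t ht.1).2]

end
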